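/- **Theorem (exponential improvement via autocurriculum for SFT).** *Setting.* Let $\Sigma$ be a finite token set, $\Sigma^*$ the set of finite or infinite strings over $\Sigma$, $\mathcal X\subseteq\Sigma^*$ a (measurable) space of prompts, $\rho$ a probability distribution on $\mathcal X$, and $T\ge 1$. A deterministic next-token model is a map $\pi:\Sigma^*\to\Sigma$. On a prompt $x$ it generates $y_t=\pi(x,y_1,\dots,y_{t-1})$ for $t=1,\dots,T$; write $\pi_{1:T}(x)=(y_1,\dots,y_T)$ and $\pi_T(x)=y_T$. Let $\Pi$ be a class of deterministic models with finite Natarajan dimension $d=\mathrm{Ndim}(\Pi)$ (the largest size of a finite $S\subseteq\Sigma^*$ for which there are $f_0,f_1:S\to\Sigma$ with $f_0(s)\neq f_1(s)$ for all $s\in S$ such that for every $B\subseteq S$ some $\pi\in\Pi$ equals $f_0$ on $B$ and $f_1$ on $S\setminus B$), and put $\bar d=\max(d,1)$. Let $\mathcal V:\mathcal X\times\Sigma\to\{0,1\}$ be a sparse verifier: for every $x$ there is exactly one $y$ with $\mathcal V(x,y)=1$. The accuracy of $f:\mathcal X\to\Sigma$ is $\mathrm{Acc}_\rho(f)=\mathbb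 E_{x\sim\rho}[\mathcal V(x,f(x))]$. Assume that some $\pi^\star\in\Pi$ has $\mathrm{Acc}_\rho(\pi^\star_T)=1$; the CoT oracle returns $\pi^\star_{1:T}(x)$ on a prompt $x$. All maps are assumed measurable; in particular the answer at $x$ of the model learned by the base learner below is jointly measurable in its training prompts and $x$ (automatic when $\mathcal X$ is countable and discrete). *Base learner.* $\mathtt{NTP}$ is any rule mapping a data set $D=\{(x_i,y^i)\}_{i=1}^m$, $y^i\in\Sigma^T$, to a minimizer over $\pi\in\Pi$ of $\frac1{mT}\sum_{i=1}^m\sum_{t=1}^T\mathbb I\big(\pi(x_i,y^i_{1:t-1})\ne y^i_t\big)$. For $c>0$ put $$n_{\mathrm{prompt}}(\varepsilon',\delta')=\left\lceil c\cdot\frac{d\,\log(T|\Sigma|)\log(1/\varepsilon')+\log(1/\delta')}{\varepsilon'}\right\rceil .$$ *Algorithm $\mathtt{AutoTune}$* with constants $C,c>0$ and parameters $\varepsilon,\delta$, on prompts $x_1,\dots,x_n$. Let $\mathrm{err}_\star=\frac14$ and $k=\lceil C\log(1/\varepsilon)/\mathrm{err}_\star^2\rceil$. For $0\le r$ let $\beta^{k,k}_r=\mathbb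 I(r\le k/2)$ and $\beta^{j,k}_r=\mathrm{err}_\star\,\beta^{j+1,k}_r+(1-\mathrm{err}_\star)\,\beta^{j+1,k}_{r+1}$ for $j<k$; let $\alpha^{j,k}_r=\beta^{j+1,k}_r-\beta^{j+1,k}_{r+1}$. Use $k$ disjoint consecutive blocks of $\lfloor n/k\rfloor$ prompts each. In phase $j=0,\dots,k-1$, with models $\hat\pi^0,\dots,\hat\pi^{j-1}$ already trained, start with an empty list $D_j$ and go through the prompts $x$ of block $j$ in order, stopping as soon as $|D_j|\ge n_{\mathrm{prompt}}(\mathrm{err}_\star,\delta/k)$: query the verifier on $x$ to obtain $\mathrm{rank}_j(x)=\sum_{i<j}\mathcal V(x,\hat\pi^i_T(x))$, draw an independent $\eta\sim\mathrm{Unif}[0,1]$, and append $x$ to $D_j$ if $\eta\le\alpha^{j,k}_{\mathrm{rank}_j(x)}/\max_{0\le r\le j}\alpha^{j,k}_r$. Then query the CoT oracle on every prompt of $D_j$ and let $\hat\pi^j$ be the output of $\mathtt{NTP}$ on $D_j$ so labelled. The output $\hat f(x)$ is a plurality vote of $\hat\pi^0_T(x),\dots,\hat\pi^{k-1}_T(x)$,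 ties broken by any fixed rule. One verifier query is the grading of one prompt $x$ against the current ensemble, i.e. the evaluation of $\mathrm{rank}_j(x)$. *Claim.* There are absolute constants $C_0,c_0>0$ such that for all $C\ge C_0$, $c\ge c_0$ there are $A>0$ and $p\in\mathbb N$, depending only on $C$ and $c$, such that the following holds in every setting as above, with $\mathrm{polylog}:=A\,\log^p\!\big(\tfrac{T|\Sigma|}{\varepsilon\delta}\big)$. Let $\varepsilon\in(0,1)$, $\delta\in(0,\frac12)$ and $$n\ \ge\ \frac{\bar d}{\varepsilon}\cdot\mathrm{polylog}.$$ Then $\mathtt{AutoTune}$, run on $n$ prompts, makes at most $n$ verifier queries (and altogether at most $nk$ single evaluations $\mathcal V(x,y)$) and at most $\bar d\cdot\mathrm{polylog}$ queries to the CoT oracle, on every run; and if $x_1,\dots,x_n\sim\rho$ are i.i.d., then with probability at least $1-\delta$ over the prompts and the variables $\eta$, $\mathrm{Acc}_\rho(\hat f)\ge 1-\varepsilon$. -/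

import Mathlib

open MeasureTheory unitInterval

namespace AutoTune

/-! ### Autoregressive models -/

/-- `Σ^*`: finite or infinite strings of tokens. -/
abbrev Str (Tok : Type*) := Stream'.Seq Tok

/-- A deterministic next-token model: every prefix is mapped to a single token. -/
abbrev Model (Tok : Type*) := Str Tok → Tok

/-- The next token that `π` produces after the prompt `x` followed by the tokens `y`. -/
def next {Tok : Type*} (π : Model Tok) (x : Str Tok) (y : List Tok) : Tok :=
  π (x.append (Stream'.Seq.ofList y))

/-- The first `t` tokens that `π` generates autoregressively on the prompt `x`. -/
def trace {Tok : Type*} (π : Model Tok) (x : Str Tok) : ℕ → List Tok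
  | 0 => []
  | t + 1 => trace π x t ++ [next π x (trace π x t)]

/-- The chain of thought `π_{1:T}(x)`. -/
def cot {Tok : Type*} (π : Model Tok) (x : Str Tok) (T : ℕ) : Fin T → Tok :=
  fun t => next π x (trace π x t)

/-- The final token `π_T(x)` (for `T ≥ 1`). -/
def answer {Tok : Type*} (π : Model Tok) (x : Str Tok) (T : ℕ) : Tok :=
  next π x (trace π x (T - 1))

/-! ### Natarajan dimension -/

/-- `S` is shattered in the sense of Natarajan by the function class `H`. -/
def NShatters {α β : Type*} (H : Set (α → β)) (S : Finset α) : Prop :=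
  ∃ f₀ f₁ : α → β, (∀ s ∈ S, f₀ s ≠ f₁ s) ∧
    ∀ B ⊆ S, ∃ h ∈ H, (∀ s ∈ B, h s = f₀ s) ∧ ∀ s ∈ S, s ∉ B → h s = f₁ s

/-- The Natarajan dimension: the largest size of a shattered set (possibly `⊤`). -/
noncomputable def Ndim {α β : Type*} (H : Set (α → β)) : ℕ∞ :=
  ⨆ (S : Finset α) (_ : NShatters H S), (S.card : ℕ∞)

/-! ### Verifier and accuracy -/

/-- The verifier accepts exactly one answer for every prompt. -/
def Sparse {X Tok : Type*} (V : X → Tok → Bool) : Prop :=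
  ∀ x, ∃! y, V x y = true

/-- Accuracy, under the prompt distribution `ρ`, of a map from prompts to answers. -/
noncomputable def acc {X Tok : Type*} [MeasurableSpace X] (ρ : Measure X)
    (V : X → Tok → Bool) (f : X → Tok) : ℝ :=
  ∫ x, (if V x (f x) = true then (1 : ℝ) else 0) ∂ρ

/-! ### Next-token prediction with the 0-1 loss -/

/-- A data set of prompts labelled with chains of thought of length `T`. -/
abbrev CoTData {Tok : Type*} (X : Set (Str Tok)) (T : ℕ) := List (X × (Fin T → Tok))

/-- The average next-token 0-1 loss of `π`. -/
noncomputable def ntpLoss {Tok : Type*} [DecidableEq Tok] {X : Set (Str Tok)} {T : ℕ}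
    (D : CoTData X T) (π : Model Tok) : ℝ :=
  1 / ((D.length : ℝ) * T) *
    (D.map fun z => ∑ t : Fin T,
      if next π z.1 ((List.ofFn z.2).take t) = z.2 t then (0 : ℝ) else 1).sum

/-- `ntp` is a next-token-prediction learner for `H`: on every data set it returns some
minimizer over `H` of the empirical next-token 0-1 loss. -/
def IsNTP {Tok : Type*} [DecidableEq Tok] {X : Set (Str Tok)} {T : ℕ}
    (H : Set (Model Tok)) (ntp : CoTData X T → Model Tok) : Prop :=
  ∀ D, ntp D ∈ H ∧ ∀ π ∈ H, ntpLoss D (ntp D) ≤ ntpLoss D π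

/-- The answer of the learned model depends measurably on the training prompts and on the
prompt at which it is evaluated, jointly. -/
def MeasurableLearner {Tok : Type*} {X : Set (Str Tok)} [MeasurableSpace X] {T : ℕ}
    (ntp : CoTData X T → Model Tok) : Prop :=
  ∀ (m : ℕ) (y : Fin m → Fin T → Tok) (a : Tok),
    MeasurableSet {p : (Fin m → X) × X |
      answer (ntp (List.ofFn fun i => (p.1 i, y i))) p.2 T = a}

/-- The number of prompts on which the base learner is trained: up to the absolute constant `c`,
`(d log(T|Σ|) log(1/ε) + log(1/δ)) / ε`, with `s = |Σ|`. -/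
noncomputable def nPrompt (c : ℝ) (d : ℕ) (ε δ : ℝ) (T s : ℕ) : ℕ :=
  ⌈c * ((d * Real.log (T * s) * Real.log (1 / ε) + Real.log (1 / δ)) / ε)⌉₊

/-! ### The weights -/

/-- The target error `err⋆` of the base learner. -/
noncomputable def errStar : ℝ := 1 / 4

/-- The number of phases. -/
noncomputable def numPhases (C ε : ℝ) : ℕ := ⌈C * Real.log (1 / ε) / errStar ^ 2⌉₊

/-- `betaRem k m r = β^{k-m,k}_r`, by recursion on the number `m` of remaining phases. -/
noncomputable def betaRem (k : ℕ) : ℕ → ℕ → ℝ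
  | 0, r => if (r : ℝ) ≤ k / 2 then 1 else 0
  | m + 1, r => errStar * betaRem k m r + (1 - errStar) * betaRem k m (r + 1)

/-- `β^{j,k}_r`, for `j ≤ k`. -/
noncomputable def beta (k j r : ℕ) : ℝ := betaRem k (k - j) r

/-- `α^{j,k}_r`, for `j < k`. -/
noncomputable def alpha (k j r : ℕ) : ℝ := beta k (j + 1) r - beta k (j + 1) (r + 1)

/-- `‖w_j‖_∞ = max_{0 ≤ r ≤ j} α^{j,k}_r`. -/
noncomputable def wMax (k j : ℕ) : ℝ :=
  (Finset.range (j + 1)).sup' ⟨0, by simp⟩ (alpha k j)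

/-- The number of models of the ensemble that answer the prompt `x` correctly. -/
def rank {Tok : Type*} {X : Set (Str Tok)} (V : X → Tok → Bool) (T : ℕ)
    (ens : List (Model Tok)) (x : X) : ℕ :=
  (ens.map fun π => (V x (answer π x T)).toNat).sum

/-! ### The subroutine `Sample` -/

/-- `out` is the list of accepted prompts; `graded` is the log of the calls to the verifier: a call
submits a prompt together with the answers of the current models and returns the rank. -/
structure SampleState {Tok : Type*} (X : Set (Str Tok)) where
  out : List X
  graded : List (X × List Tok)

/-- The loop of `Sample` over the remaining prompts, each of which comes with its own uniform
variable `η`. The loop stops as soon as `cap` prompts have been accepted. -/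
noncomputable def sampleLoop {Tok : Type*} {X : Set (Str Tok)} (V : X → Tok → Bool) (T k cap : ℕ)
    (ens : List (Model Tok)) : List (X × I) → SampleState X → SampleState X
  | [], s => s
  | (x, η) :: l, s =>
    if cap ≤ s.out.length then s
    else sampleLoop V T k cap ens l
      { out :=
          if (η : ℝ) ≤ alpha k ens.length (rank V T ens x) / wMax k ens.length
          then s.out ++ [x] else s.out
        graded := s.graded ++ [(x, ens.map fun π => answer π x T)] }

/-! ### `AutoTune` -/

/-- The ensemble, the log of calls to the verifier, and the log of queries to the CoT oracle. -/
structure State {Tok : Type*} (X : Set (Str Tok)) where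
  models : List (Model Tok)
  graded : List (X × List Tok)
  cotQueries : List X

/-- The state after the first `j` phases. Phase `j` uses the `j`-th block of `⌊n/k⌋` prompts of
`data`, which has length `n`. -/
noncomputable def run {Tok : Type*} {X : Set (Str Tok)} {T : ℕ} (V : X → Tok → Bool)
    (oracle : X → Fin T → Tok) (ntp : CoTData X T → Model Tok) (k cap : ℕ)
    (data : List (X × I)) : ℕ → State X
  | 0 => ⟨[], [], []⟩
  | j + 1 =>
    let s := run V oracle ntp k cap data j
    let b := data.length / k
    let S := sampleLoop V T k cap s.models ((data.drop (j * b)).take b) ⟨[], []⟩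
    { models := s.models ++ [ntp (S.out.map fun x => (x, oracle x))]
      graded := s.graded ++ S.graded
      cotQueries := s.cotQueries ++ S.out }

/-- `plu` returns a most frequent element of every nonempty list (ties are broken arbitrarily). -/
def IsPlurality {Tok : Type*} [DecidableEq Tok] (plu : List Tok → Tok) : Prop :=
  ∀ l : List Tok, l ≠ [] → ∀ a, l.count a ≤ l.count (plu l)

/-- The plurality vote of an ensemble. -/
def vote {Tok : Type*} {X : Set (Str Tok)} (plu : List Tok → Tok) (T : ℕ)
    (ens : List (Model Tok)) (x : X) : Tok :=
  plu (ens.map fun π => answer π x T)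

/-- The final state of `AutoTune` with target error `ε` and failure probability `δ`, run with `NTP`
as base learner on the prompts and uniform variables `data`; `C` and `c` are the absolute constants
in the number of phases and in the sample complexity of `NTP`, and `d` is the Natarajan dimension
of the model class. -/
noncomputable def autoTune {Tok : Type*} [Fintype Tok] {X : Set (Str Tok)} {T : ℕ} (C c : ℝ)
    (d : ℕ) (ε δ : ℝ) (V : X → Tok → Bool) (oracle : X → Fin T → Tok)
    (ntp : CoTData X T → Model Tok) (data : List (X × I)) : State X :=
  let k := numPhases C ε
  run V oracle ntp k (nPrompt c d errStar (δ / k) T (Fintype.card Tok)) data k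

/-- A polylogarithmic factor in `1/ε`, `1/δ`, `T` and `s = |Σ|`. -/
noncomputable def polylog (A : ℝ) (p : ℕ) (ε δ : ℝ) (T s : ℕ) : ℝ :=
  A * Real.log (T * s / (ε * δ)) ^ p

end AutoTune

/-!
`AutoTune` is boosting by majority, and its analysis combines three independent facts.

*Boosting.* Let `Φ_j` be the mean over prompts of `β^{j,k}` at the current rank (`potential`). The
recursion for `β` gives
`Φ_{j+1} = Φ_j + E[w_j · 1(the new model is wrong)] - E[w_j] / 4` with `w_j = α^{j,k}_{rank_j}`.
So the potential does not increase when the new model has error at most `1/4` on prompts reweighted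
by `w_j`, and it increases by at most the acceptance probability in any case
(`potential_append_le`). A phase *fails* (`PhaseFails`) if the acceptance probability exceeds
`ε / (4k)` and yet the new model has reweighted error above `1/4`. If no phase fails, the final
potential is at most `Φ_0 + ε / 4`, and `Φ_0 ≤ 3ε / 4` by an exponential Markov inequality
(`beta_numPhases_le`). The final potential is the probability that at most half of the models are
right, which bounds the error of the plurality vote (`one_sub_potential_le_acc`).

*Rejection sampling.* For a fixed ensemble, the accepted prompts of a block are independent samples
from the reweighted distribution (`iidE_sampleLoop_full`), and by a Chernoff bound there are enough
of them (`iidE_sampleLoop_short`). A block is independent of the earlier ones, so the bound carries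
over to the random ensemble of a run (`prob_phaseFails_le`), and a union bound over the phases
concludes.

*Generalization of the base learner.* The learner is consistent with the chains of thought of the
perfect model `π⋆`, and whether a model reproduces such a chain depends only on its next tokens
at the `T` prefixes of that chain. Hence on `2m` prompts the error patterns are controlled by the
Natarajan form of the Sauer–Shelah lemma at `2mT` points (`exists_cover`,
`exists_deviation_cover`). A consistent learner is compared with a fresh sample by swapping
training and fresh points at random (`prob_large_error_le`): the expectation of `2 ^ #(fresh
errors)` is at most the number of patterns, but is at least `(5/4) ^ m` on the event that the error
exceeds `1/4`. Events are formulated for the given learner, not uniformly over the class, so that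
measurability of its answers is all that is needed.
-/

namespace AutoTune

/-! ### Growth of classes of finite Natarajan dimension -/

/-- The part of `H` that admits, on `insert a S`, both continuations `u` and `v` at `a` of the
same values on `S`; its members take the value `u` at `a`. -/
def twin {α β : Type*} (H : Set (α → β)) (S : Finset α) (a : α) (u v : β) : Set (α → β) :=
  {h | h ∈ H ∧ h a = u ∧ ∃ h' ∈ H, (∀ s ∈ S, h' s = h s) ∧ h' a = v}

/-- A set shattered by the twin class stays shattered by `H` after adding `a`. -/
lemma NShatters.insert_of_twin {α β : Type*} [DecidableEq α] {H : Set (α → β)} {S : Finset α}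
    {a : α} (ha : a ∉ S) {u v : β} (huv : u ≠ v) {B : Finset α} (hB : B ⊆ S)
    (h : NShatters (twin H S a u v) B) : NShatters H (insert a B) := by
  obtain ⟨f₀, f₁, hne, hsh⟩ := h
  have haB : a ∉ B := fun h => ha (hB h)
  have hna : ∀ s ∈ B, s ≠ a := fun s hs h => haB (h ▸ hs)
  refine ⟨Function.update f₀ a u, Function.update f₁ a v, ?_, ?_⟩
  · intro s hs
    rcases Finset.mem_insert.1 hs with rfl | hs
    · simpa using huv
    · simpa [hna s hs] using hne s hs
  · intro C hC
    obtain ⟨g, ⟨hgH, hgu, g', hg'H, hgg', hg'v⟩, hg0, hg1⟩ :=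
      hsh (C.erase a) (fun s hs => by
        have := hC (Finset.mem_of_mem_erase hs)
        exact (Finset.mem_insert.1 this).resolve_left (Finset.ne_of_mem_erase hs))
    by_cases haC : a ∈ C
    · refine ⟨g, hgH, fun s hs => ?_, fun s hs hsC => ?_⟩
      · by_cases hsa : s = a
        · simp [hsa, hgu]
        · simpa [hsa] using hg0 s (Finset.mem_erase.2 ⟨hsa, hs⟩)
      · have hsa : s ≠ a := fun h => hsC (h ▸ haC)
        have hsB := (Finset.mem_insert.1 hs).resolve_left hsa
        simpa [hsa] using hg1 s hsB (fun h => hsC (Finset.mem_of_mem_erase h))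
    · refine ⟨g', hg'H, fun s hs => ?_, fun s hs hsC => ?_⟩
      · have hsa : s ≠ a := fun h => haC (h ▸ hs)
        have hsB := (Finset.mem_insert.1 (hC hs)).resolve_left hsa
        rw [hgg' s (hB hsB)]
        simpa [hsa] using hg0 s (Finset.mem_erase.2 ⟨hsa, hs⟩)
      · by_cases hsa : s = a
        · simp [hsa, hg'v]
        · have hsB := (Finset.mem_insert.1 hs).resolve_left hsa
          rw [hgg' s (hB hsB)]
          simpa [hsa] using hg1 s hsB (fun h => hsC (Finset.mem_of_mem_erase h))

/-- The Natarajan form of the Sauer–Shelah lemma: a class of dimension at most `d` on `S` is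
represented on `S` by few functions. The bound is stated as a generating function, whose parameter
`z` is at the reader's disposal. -/
lemma exists_cover {α β : Type*} [DecidableEq α] [Fintype β] [DecidableEq β] {z : ℝ} (hz : 0 < z)
    (hz1 : z ≤ 1) (S : Finset α) : ∀ (H : Set (α → β)) (d : ℕ),
    (∀ B ⊆ S, NShatters H B → B.card ≤ d) →
    ∃ R : Finset (α → β), (R.card : ℝ) ≤
        (z⁻¹) ^ d * (1 + (Fintype.card β : ℝ) ^ 2 * z) ^ S.card ∧
      ∀ h ∈ H, ∃ r ∈ R, ∀ s ∈ S, r s = h s := by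
  classical
  have hzi : 1 ≤ z⁻¹ := (one_le_inv₀ hz).2 hz1
  induction S using Finset.induction_on with
  | empty =>
    intro H d _
    by_cases hH : H.Nonempty
    · obtain ⟨h, -⟩ := hH
      refine ⟨{h}, ?_, fun g _ => ⟨h, by simp, by simp⟩⟩
      simpa using one_le_pow₀ hzi
    · exact ⟨∅, by simp; positivity, fun g hg => (hH ⟨g, hg⟩).elim⟩
  | insert a S ha ih =>
    intro H d hd
    obtain ⟨R₀, hR₀, hc₀⟩ := ih H d (fun B hB => hd B (hB.trans (Finset.subset_insert _ _)))
    set q : ℝ := (Fintype.card β : ℝ) ^ 2 with hq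
    have hq0 : 0 ≤ q := by positivity
    have hpos : 0 ≤ (z⁻¹) ^ d * (1 + q * z) ^ S.card := by positivity
    -- A cover of each twin class; its dimension drops by one, which gains a factor `z`.
    have htw : ∀ p : β × β, ∃ R : Finset (α → β),
        (R.card : ℝ) ≤ z * ((z⁻¹) ^ d * (1 + q * z) ^ S.card) ∧
        (p.1 ≠ p.2 → ∀ h ∈ twin H S a p.1 p.2, ∃ r ∈ R, ∀ s ∈ S, r s = h s) := by
      rintro ⟨u, v⟩
      by_cases huv : u = v
      · exact ⟨∅, by simpa using mul_nonneg hz.le hpos, fun h => (h huv).elim⟩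
      by_cases hne : (twin H S a u v).Nonempty
      · have hcard : ∀ B ⊆ S, NShatters (twin H S a u v) B → B.card + 1 ≤ d := by
          intro B hB hsh
          have := hd (insert a B) (Finset.insert_subset_insert _ hB)
            (hsh.insert_of_twin ha huv hB)
          rwa [Finset.card_insert_of_notMem (fun h => ha (hB h))] at this
        have hd1 : 1 ≤ d := by
          obtain ⟨h, hh⟩ := hne
          have := hcard ∅ (by simp) ⟨fun _ => u, fun _ => v, by simp,
            fun B hB => ⟨h, hh, by
              have : B = ∅ := Finset.subset_empty.1 hB
              simp [this]⟩⟩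
          omega
        obtain ⟨R, hR, hc⟩ := ih (twin H S a u v) (d - 1)
          (fun B hB hsh => by have := hcard B hB hsh; omega)
        refine ⟨R, hR.trans (le_of_eq ?_), fun _ => hc⟩
        obtain ⟨e, rfl⟩ : ∃ e, d = e + 1 := ⟨d - 1, by omega⟩
        simp only [Nat.add_sub_cancel, pow_succ]
        field_simp
      · exact ⟨∅, by simpa using mul_nonneg hz.le hpos, fun _ h hh => (hne ⟨h, hh⟩).elim⟩
    choose Rt hRt hct using htw
    -- The value at `a` given to a representative of the restrictions to `S`.
    let w : (α → β) → β := fun r =>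
      if hr : ∃ h ∈ H, ∀ s ∈ S, h s = r s then hr.choose a else r a
    refine ⟨R₀.image (fun r => Function.update r a (w r)) ∪
      Finset.univ.biUnion (fun p : β × β => (Rt p).image fun r => Function.update r a p.2),
      ?_, ?_⟩
    · have h1 : ((R₀.image (fun r => Function.update r a (w r)) ∪
          Finset.univ.biUnion (fun p : β × β =>
            (Rt p).image fun r => Function.update r a p.2)).card : ℝ) ≤
          R₀.card + ∑ p : β × β, ((Rt p).card : ℝ) := by
        have h2 := Finset.card_union_le (R₀.image (fun r => Function.update r a (w r)))
          (Finset.univ.biUnion (fun p : β × β =>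
            (Rt p).image fun r => Function.update r a p.2))
        have h3 : (Finset.univ.biUnion (fun p : β × β =>
            (Rt p).image fun r => Function.update r a p.2)).card ≤ ∑ p : β × β, (Rt p).card :=
          Finset.card_biUnion_le.trans (Finset.sum_le_sum fun p _ => Finset.card_image_le)
        have h4 : (R₀.image (fun r => Function.update r a (w r))).card ≤ R₀.card :=
          Finset.card_image_le
        have h5 := h2.trans (add_le_add h4 h3)
        exact_mod_cast h5
      refine h1.trans ((add_le_add hR₀ (Finset.sum_le_sum fun p _ => hRt p)).trans
        (le_of_eq ?_))
      rw [Finset.sum_const, Finset.card_univ, Fintype.card_prod,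
        Finset.card_insert_of_notMem ha, pow_succ, nsmul_eq_mul, hq]
      push_cast
      ring
    · intro h hh
      obtain ⟨r, hr, hrs⟩ := hc₀ h hh
      have hex : ∃ h ∈ H, ∀ s ∈ S, h s = r s := ⟨h, hh, fun s hs => (hrs s hs).symm⟩
      have hw : w r = hex.choose a := dif_pos hex
      obtain ⟨h0H, h0S⟩ := hex.choose_spec
      by_cases hwa : w r = h a
      · refine ⟨_, Finset.mem_union_left _ (Finset.mem_image_of_mem _ hr), fun s hs => ?_⟩
        by_cases hsa : s = a
        · simp [hsa, hwa]
        · simpa [hsa] using hrs s ((Finset.mem_insert.1 hs).resolve_left hsa)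
      · obtain ⟨r', hr', hrs'⟩ := hct (w r, h a) hwa hex.choose
          ⟨h0H, hw.symm, h, hh, fun s hs => by rw [h0S s hs, hrs s hs], rfl⟩
        refine ⟨Function.update r' a (h a), Finset.mem_union_right _ (Finset.mem_biUnion.2
          ⟨(w r, h a), Finset.mem_univ _, Finset.mem_image.2 ⟨r', hr', rfl⟩⟩), fun s hs => ?_⟩
        by_cases hsa : s = a
        · simp [hsa]
        · have hsS := (Finset.mem_insert.1 hs).resolve_left hsa
          simp [hsa, hrs' s hsS, h0S s hsS, hrs s hsS]

lemma NShatters.card_le_of_Ndim {α β : Type*} {H : Set (α → β)} {d : ℕ} (hd : Ndim H = d)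
    {B : Finset α} (hB : NShatters H B) : B.card ≤ d := by
  have : (B.card : ℕ∞) ≤ Ndim H :=
    le_iSup₂ (f := fun (S : Finset α) (_ : NShatters H S) => (S.card : ℕ∞)) B hB
  rw [hd] at this
  exact_mod_cast this

/-- A positive Natarajan dimension requires two tokens. -/
lemma two_le_card_of_Ndim {α β : Type*} [Fintype β] {H : Set (α → β)} {d : ℕ} (hd : Ndim H = d)
    (h0 : d ≠ 0) : 2 ≤ Fintype.card β := by
  by_contra hlt
  have hs : Subsingleton β := Fintype.card_le_one_iff_subsingleton.1 (by omega)
  apply h0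
  have : Ndim H = 0 := by
    refine le_antisymm (iSup₂_le fun S hS => ?_) bot_le
    obtain ⟨f₀, f₁, hne, -⟩ := hS
    have : S = ∅ := Finset.eq_empty_of_forall_notMem fun s hs =>
      hne s hs (Subsingleton.elim _ _)
    simp [this]
  rw [hd] at this
  exact_mod_cast this

/-! ### Chains of thought and consistency of the base learner -/

lemma length_trace {Tok : Type*} (π : Model Tok) (x : Str Tok) (t : ℕ) :
    (trace π x t).length = t := by
  induction t with
  | zero => rfl
  | succ t ih => simp [trace, ih]

lemma take_trace {Tok : Type*} (π : Model Tok) (x : Str Tok) {t T : ℕ} (h : t ≤ T) :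
    (trace π x T).take t = trace π x t := by
  induction T, h using Nat.le_induction with
  | base => exact List.take_of_length_le (length_trace π x t).le
  | succ T hT ih =>
    rw [trace, List.take_append_of_le_length (by rw [length_trace]; exact hT), ih]

lemma ofFn_cot {Tok : Type*} (π : Model Tok) (x : Str Tok) (T : ℕ) :
    List.ofFn (cot π x T) = trace π x T := by
  induction T with
  | zero => rfl
  | succ T ih =>
    rw [List.ofFn_succ', List.concat_eq_append, trace]
    congr 1

/-- Along the chain of thought of `πs` on `x`, the model `π` predicts some token wrongly. -/
def Deviates {Tok : Type*} (πs : Model Tok) (T : ℕ) (π : Model Tok) (x : Str Tok) : Prop :=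
  ∃ t < T, next π x (trace πs x t) ≠ next πs x (trace πs x t)

lemma Deviates.of_answer_ne {Tok : Type*} {πs π : Model Tok} {T : ℕ} (hT : 1 ≤ T) {x : Str Tok}
    (h : answer π x T ≠ answer πs x T) : Deviates πs T π x := by
  by_contra hd
  simp only [Deviates, not_exists, not_and, not_not] at hd
  have htr : ∀ t ≤ T, trace π x t = trace πs x t := by
    intro t ht
    induction t with
    | zero => rfl
    | succ t ih => rw [trace, trace, ih (by omega), hd t (by omega)]
  exact h (by rw [answer, answer, htr _ (by omega), hd _ (by omega)])

lemma answer_eq_cot {Tok : Type*} (π : Model Tok) (x : Str Tok) {T : ℕ} (hT : 1 ≤ T) :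
    answer π x T = cot π x T ⟨T - 1, by omega⟩ := rfl

/-- On data labelled by a member of the class, a next-token-prediction learner reproduces every
label. -/
lemma IsNTP.not_deviates {Tok : Type*} [DecidableEq Tok] {X : Set (Str Tok)} {T : ℕ} (hT : 1 ≤ T)
    {H : Set (Model Tok)} {ntp : CoTData X T → Model Tok} (hntp : IsNTP H ntp) {πs : Model Tok}
    (hπ : πs ∈ H) (l : List X) {x : X} (hx : x ∈ l) :
    ¬ Deviates πs T (ntp (l.map fun x => (x, cot πs x T))) x := by
  set D : CoTData X T := l.map fun x => (x, cot πs x T) with hD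
  have hloss : ∀ π : Model Tok, ntpLoss D π = 1 / ((l.length : ℝ) * T) *
      (l.map fun x : X => ∑ t : Fin T, if next π x (trace πs x t) = next πs x (trace πs x t)
        then (0 : ℝ) else 1).sum := by
    intro π
    simp only [ntpLoss, hD, List.length_map, List.map_map, Function.comp_def, ofFn_cot]
    congr 3
    funext x
    refine Finset.sum_congr rfl fun t _ => ?_
    rw [take_trace _ _ t.2.le]
    rfl
  have h1 := (hntp D).2 πs hπ
  rw [hloss, hloss] at h1
  simp only [if_true, Finset.sum_const_zero, List.map_const', List.sum_replicate, smul_zero,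
    mul_zero] at h1
  have hlen : 0 < l.length := List.length_pos_of_mem hx
  have hc : (0 : ℝ) < 1 / ((l.length : ℝ) * T) := by
    have : (0 : ℝ) < l.length := by exact_mod_cast hlen
    have : (0 : ℝ) < T := by exact_mod_cast hT
    positivity
  rintro ⟨t, ht, hne⟩
  have hnn : ∀ y ∈ (l.map fun x : X => ∑ t : Fin T,
      if next (ntp D) x (trace πs x t) = next πs x (trace πs x t) then (0 : ℝ) else 1),
      0 ≤ y := by
    intro y hy
    obtain ⟨x, -, rfl⟩ := List.mem_map.1 hy
    exact Finset.sum_nonneg fun t _ => by split_ifs <;> norm_num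
  have h2 : (1 : ℝ) ≤ ∑ t : Fin T,
      if next (ntp D) x (trace πs x t) = next πs x (trace πs x t) then (0 : ℝ) else 1 := by
    refine le_trans ?_ (Finset.single_le_sum (fun t _ => ?_) (Finset.mem_univ (⟨t, ht⟩ : Fin T)))
    · simp [hne]
    · split_ifs <;> norm_num
  have h3 := List.single_le_sum hnn _ (List.mem_map_of_mem hx)
  nlinarith [mul_le_mul_of_nonneg_left (h2.trans h3) hc.le]

/-- The next-token errors that the members of `H` make along the chains of thought of `πs` on a
finite set `P` of prompts form few patterns. -/
lemma exists_deviation_cover {Tok : Type*} [Fintype Tok] {H : Set (Model Tok)}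
    {d : ℕ} (hd : Ndim H = d) (πs : Model Tok) (T : ℕ) {z : ℝ} (hz : 0 < z) (hz1 : z ≤ 1)
    (P : Finset (Str Tok)) {N : ℕ} (hN : P.card ≤ N) :
    ∃ R : Finset (Model Tok), (R.card : ℝ) ≤
        (z⁻¹) ^ d * (1 + (Fintype.card Tok : ℝ) ^ 2 * z) ^ (N * T) ∧
      ∀ π ∈ H, ∃ r ∈ R, ∀ x ∈ P, (Deviates πs T r x ↔ Deviates πs T π x) := by
  classical
  let S : Finset (Str Tok) := P.biUnion fun x => (Finset.range T).image fun t =>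
    x.append (Stream'.Seq.ofList (trace πs x t))
  have hS : S.card ≤ N * T := by
    refine (Finset.card_biUnion_le_card_mul _ _ T fun x _ => ?_).trans
      (Nat.mul_le_mul_right _ hN)
    exact Finset.card_image_le.trans (by simp)
  obtain ⟨R, hR, hc⟩ := exists_cover hz hz1 S H d (fun B _ hB => hB.card_le_of_Ndim hd)
  refine ⟨R, hR.trans ?_, fun π hπ => ?_⟩
  · refine mul_le_mul_of_nonneg_left (pow_le_pow_right₀ ?_ hS) (by positivity)
    have : 0 ≤ (Fintype.card Tok : ℝ) ^ 2 * z := by positivity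
    linarith
  · obtain ⟨r, hr, hrs⟩ := hc π hπ
    refine ⟨r, hr, fun x hx => ?_⟩
    refine exists_congr fun t => and_congr_right fun ht => ?_
    have : next r x (trace πs x t) = next π x (trace πs x t) :=
      hrs _ (Finset.mem_biUnion.2 ⟨x, hx, Finset.mem_image.2 ⟨t, Finset.mem_range.2 ht, rfl⟩⟩)
    rw [this]

/-! ### Expectations over lists of independent samples -/

/-- The expectation of `F` over a list of `n` independent samples from `μ`, as an iterated
integral. -/
noncomputable def iidE {Z : Type*} [MeasurableSpace Z] (μ : Measure Z) :
    ℕ → (List Z → ENNReal) → ENNReal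
  | 0, F => F []
  | n + 1, F => ∫⁻ z, iidE μ n (fun l => F (z :: l)) ∂μ

section iidE
variable {Z : Type*} [MeasurableSpace Z] (μ : Measure Z)

lemma iidE_mono {n : ℕ} {F G : List Z → ENNReal} (h : ∀ l, l.length = n → F l ≤ G l) :
    iidE μ n F ≤ iidE μ n G := by
  induction n generalizing F G with
  | zero => exact h [] rfl
  | succ n ih => exact lintegral_mono fun z => ih fun l hl => h _ (by simp [hl])

lemma iidE_const [IsProbabilityMeasure μ] (n : ℕ) (a : ENNReal) : iidE μ n (fun _ => a) = a := by
  induction n with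
  | zero => rfl
  | succ n ih => simp [iidE, ih]

lemma iidE_append (a b : ℕ) (F : List Z → ENNReal) :
    iidE μ (a + b) F = iidE μ a fun l₁ => iidE μ b fun l₂ => F (l₁ ++ l₂) := by
  induction a generalizing F with
  | zero => simp [iidE]
  | succ a ih => rw [Nat.succ_add]; simp only [iidE, ih, List.cons_append]

lemma iidE_prod {f : Z → ENNReal} (hf : Measurable f) (n : ℕ) :
    iidE μ n (fun l => (l.map f).prod) = (∫⁻ z, f z ∂μ) ^ n := by
  have h : ∀ (n : ℕ) (a : ENNReal),
      iidE μ n (fun l => a * (l.map f).prod) = a * (∫⁻ z, f z ∂μ) ^ n := by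
    intro n
    induction n with
    | zero => intro a; simp [iidE]
    | succ n ih =>
      intro a
      simp only [iidE, List.map_cons, List.prod_cons, ← mul_assoc, ih]
      rw [lintegral_mul_const _ (hf.const_mul a), lintegral_const_mul _ hf, pow_succ']
      ring
  simpa using h n 1

lemma lintegral_pi_ofFn [IsProbabilityMeasure μ] (n : ℕ) {F : List Z → ENNReal}
    (hF : Measurable fun v : Fin n → Z => F (List.ofFn v)) :
    ∫⁻ v, F (List.ofFn v) ∂(Measure.pi fun _ : Fin n => μ) = iidE μ n F := by
  induction n generalizing F with
  | zero => simp [iidE]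
  | succ n ih =>
    have hmp := (measurePreserving_piFinSuccAbove (fun _ : Fin (n + 1) => μ) 0).symm
    have hcons : ∀ p : Z × (Fin n → Z), List.ofFn
        ((MeasurableEquiv.piFinSuccAbove (fun _ : Fin (n + 1) => Z) 0).symm p) =
          p.1 :: List.ofFn p.2 := by
      intro p
      rw [List.ofFn_succ]
      simp [MeasurableEquiv.piFinSuccAbove]
    have hF' : Measurable fun p : Z × (Fin n → Z) => F (p.1 :: List.ofFn p.2) := by
      have := hF.comp hmp.measurable
      simpa only [Function.comp_def, hcons] using this
    rw [← hmp.lintegral_comp hF]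
    simp only [hcons]
    rw [lintegral_prod _ hF'.aemeasurable]
    exact lintegral_congr fun z => ih (F := fun l => F (z :: l)) (hF'.comp measurable_prodMk_left)

lemma measurable_iidE {Ω : Type*} [MeasurableSpace Ω] [IsProbabilityMeasure μ] (n : ℕ)
    {F : Ω → List Z → ENNReal}
    (hF : Measurable fun p : Ω × (Fin n → Z) => F p.1 (List.ofFn p.2)) :
    Measurable fun ω => iidE μ n (F ω) := by
  have : ∀ ω, iidE μ n (F ω) = ∫⁻ v, F ω (List.ofFn v) ∂(Measure.pi fun _ : Fin n => μ) :=
    fun ω => (lintegral_pi_ofFn μ n (hF.comp measurable_prodMk_left)).symm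
  simp only [this]
  exact hF.lintegral_prod_right'

lemma iidE_add_le [IsProbabilityMeasure μ] {n : ℕ}
    {F G : List Z → ENNReal} (hF : Measurable fun v : Fin n → Z => F (List.ofFn v)) :
    iidE μ n (fun l => F l + G l) ≤ iidE μ n F + iidE μ n G := by
  induction n generalizing F G with
  | zero => exact le_rfl
  | succ n ih =>
    have hF' : Measurable fun p : Z × (Fin n → Z) => F (p.1 :: List.ofFn p.2) := by
      have hcons : ∀ p : Z × (Fin n → Z), p.1 :: List.ofFn p.2 =
          List.ofFn (n := n + 1) (Fin.cons p.1 p.2) := by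
        intro p; simp [List.ofFn_succ]
      simp only [hcons]
      refine hF.comp (measurable_pi_iff.2 fun i => ?_)
      refine Fin.cases ?_ (fun i => ?_) i
      · simp only [Fin.cons_zero]; exact measurable_fst
      · simp only [Fin.cons_succ]; exact (measurable_pi_apply i).comp measurable_snd
    simp only [iidE]
    rw [← lintegral_add_left (measurable_iidE μ n hF')]
    exact lintegral_mono fun z =>
      ih (F := fun l => F (z :: l)) (G := fun l => G (z :: l)) (hF'.comp measurable_prodMk_left)

end iidE

/-! ### Generalization of consistent learners by random swaps -/

/-- Exchange the two entries of the `i`-th pair whenever `τ i`. -/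
def swapPairs {X : Type*} {m : ℕ} (τ : Fin m → Bool) (w : Fin m → X × X) : Fin m → X × X :=
  fun i => if τ i then (w i).swap else w i

/-- A consistent learner on `m` samples, whose error sets realize at most `G` patterns on `2m`
points, has error above `1/4` with probability at most `G (4/5)^m`.

The expectation of `2 ^ #(errors on a fresh sample of size m)` is at least `(5/4)^m` on that event.
Exchanging the training sample and the fresh sample at random coordinates bounds it by `G`:
for a single pattern, a pair of points with one error contributes `2` with probability `1/2` and is
inconsistent with the training sample otherwise. -/
lemma prob_large_error_le {X : Type*} [MeasurableSpace X] (D : Measure X) [IsProbabilityMeasure D]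
    {m : ℕ} {E : Set ((Fin m → X) × X)} (hE : MeasurableSet E) {G : ENNReal}
    (hG : ∀ w : Fin m → X × X, ∃ R : Finset (Set X), (R.card : ENNReal) ≤ G ∧
      ∀ τ : Fin m → Bool, ∃ r ∈ R, (∀ i, (swapPairs τ w i).1 ∉ r) ∧
        ∀ i, ((fun i => (swapPairs τ w i).1), (swapPairs τ w i).2) ∈ E →
          (swapPairs τ w i).2 ∈ r) :
    (Measure.pi fun _ : Fin m => D) {v | 1 / 4 < D {x | (v, x) ∈ E}} * (5 / 4) ^ m ≤ G := by
  classical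
  let f : (Fin m → X) → X → ENNReal := fun v x => if (v, x) ∈ E then 2 else 1
  have hf : Measurable fun p : (Fin m → X) × X => f p.1 p.2 :=
    Measurable.ite hE measurable_const measurable_const
  let Z : (Fin m → X) × (Fin m → X) → ENNReal := fun p => ∏ i, f p.1 (p.2 i)
  have hZ : Measurable Z := Finset.measurable_prod _ fun i _ =>
    hf.comp (measurable_fst.prodMk ((measurable_pi_apply i).comp measurable_snd))
  set P := Measure.pi fun _ : Fin m => D with hP
  have hbad : MeasurableSet {v : Fin m → X | 1 / 4 < D {x | (v, x) ∈ E}} :=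
    measurableSet_lt measurable_const (measurable_measure_prodMk_left hE)
  have hlow : P {v | 1 / 4 < D {x | (v, x) ∈ E}} * (5 / 4) ^ m ≤ ∫⁻ p, Z p ∂(P.prod P) := by
    rw [lintegral_prod _ hZ.aemeasurable]
    have hin : ∀ v, ∫⁻ v', Z (v, v') ∂P = (1 + D {x | (v, x) ∈ E}) ^ m := by
      intro v
      have hfv : Measurable (f v) := hf.comp measurable_prodMk_left
      have hEv : MeasurableSet {x | (v, x) ∈ E} := measurable_prodMk_left hE
      have h1 := lintegral_pi_ofFn D m (F := fun l => (l.map (f v)).prod) (by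
        simp only [List.map_ofFn, List.prod_ofFn]
        exact Finset.measurable_prod _ fun i _ => hfv.comp (measurable_pi_apply i))
      rw [iidE_prod D hfv] at h1
      simp only [List.map_ofFn, List.prod_ofFn, Function.comp_apply] at h1
      rw [← hP] at h1
      simp only [Z]
      rw [h1]
      congr 1
      have h2 : f v = fun x => 1 + Set.indicator {x | (v, x) ∈ E} (fun _ => 1) x := by
        funext x
        by_cases h : (v, x) ∈ E
        · simp [f, h, one_add_one_eq_two]
        · simp [f, h]
      rw [h2, lintegral_add_left measurable_const, lintegral_indicator hEv]
      simp
    simp only [hin]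
    calc P {v | 1 / 4 < D {x | (v, x) ∈ E}} * (5 / 4) ^ m
        = ∫⁻ v in {v | 1 / 4 < D {x | (v, x) ∈ E}}, (5 / 4) ^ m ∂P := by
          rw [setLIntegral_const, mul_comm]
      _ ≤ ∫⁻ v in {v | 1 / 4 < D {x | (v, x) ∈ E}}, (1 + D {x | (v, x) ∈ E}) ^ m ∂P := by
          refine setLIntegral_mono' hbad fun v hv => pow_le_pow_left' ?_ m
          have h54 : (5 / 4 : ENNReal) = 1 + 1 / 4 := by
            rw [← ENNReal.toReal_eq_toReal_iff' (by finiteness) (by finiteness),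
              ENNReal.toReal_add (by finiteness) (by finiteness)]
            norm_num
          rw [h54]
          gcongr
          exact hv.le
      _ ≤ _ := setLIntegral_le_lintegral _ _
  refine hlow.trans ?_
  -- The same integral over a single sample of pairs, and its average over all swaps.
  let Q := Measure.pi fun _ : Fin m => D.prod D
  let Y : (Fin m → X × X) → ENNReal := fun w => Z ((fun i => (w i).1), fun i => (w i).2)
  have hY : Measurable Y := hZ.comp (by fun_prop)
  have hQ : ∫⁻ p, Z p ∂(P.prod P) = ∫⁻ w, Y w ∂Q :=
    ((measurePreserving_arrowProdEquivProdArrow X X (Fin m) (fun _ => D)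
      (fun _ => D)).lintegral_comp hZ).symm
  have hswap : ∀ τ : Fin m → Bool, MeasurePreserving (swapPairs (X := X) τ) Q Q := by
    intro τ
    refine measurePreserving_pi (fun _ => D.prod D) (fun _ => D.prod D)
      (f := fun i p => if τ i then p.swap else p) fun i => ?_
    by_cases h : τ i
    · simpa [h] using Measure.measurePreserving_swap
    · simp only [h, Bool.false_eq_true, if_false]
      exact MeasurePreserving.id _
  have hsum : ∀ w, ∑ τ : Fin m → Bool, Y (swapPairs τ w) ≤ 2 ^ m * G := by
    intro w
    obtain ⟨R, hR, hτ⟩ := hG w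
    let g : Set X → Fin m → Bool → ENNReal := fun r i b =>
      if (if b then (w i).2 else (w i).1) ∈ r then 0
      else if (if b then (w i).1 else (w i).2) ∈ r then 2 else 1
    have h1 : ∀ τ : Fin m → Bool, Y (swapPairs τ w) ≤ ∑ r ∈ R, ∏ i, g r i (τ i) := by
      intro τ
      obtain ⟨r, hr, hc, he⟩ := hτ τ
      refine le_trans ?_ (Finset.single_le_sum (fun _ _ => zero_le) hr)
      refine Finset.prod_le_prod' fun i _ => ?_
      have hci := hc i
      have hei := he i
      have e1 : (if τ i then (w i).2 else (w i).1) = (swapPairs τ w i).1 := by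
        by_cases h : τ i <;> simp [swapPairs, h]
      have e2 : (if τ i then (w i).1 else (w i).2) = (swapPairs τ w i).2 := by
        by_cases h : τ i <;> simp [swapPairs, h]
      simp only [g, e1, e2, if_neg hci, f]
      split_ifs with h2 h3 h3
      · exact le_rfl
      · exact (h3 (hei h2)).elim
      · exact one_le_two
      · exact le_rfl
    calc ∑ τ : Fin m → Bool, Y (swapPairs τ w)
        ≤ ∑ τ : Fin m → Bool, ∑ r ∈ R, ∏ i, g r i (τ i) := Finset.sum_le_sum fun τ _ => h1 τ
      _ = ∑ r ∈ R, ∏ i, ∑ b : Bool, g r i b := by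
          rw [Finset.sum_comm]
          refine Finset.sum_congr rfl fun r _ => ?_
          rw [Finset.prod_univ_sum, Fintype.piFinset_univ]
      _ ≤ ∑ r ∈ R, 2 ^ m := by
          refine Finset.sum_le_sum fun r _ => ?_
          refine (Finset.prod_le_pow_card _ _ 2 fun i _ => ?_).trans (by simp)
          by_cases ha : (w i).1 ∈ r <;> by_cases hb : (w i).2 ∈ r <;>
            simp [g, ha, hb, one_add_one_eq_two]
      _ = 2 ^ m * R.card := by rw [Finset.sum_const, nsmul_eq_mul, mul_comm]
      _ ≤ 2 ^ m * G := by gcongr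
  have hint : 2 ^ m * ∫⁻ w, Y w ∂Q ≤ 2 ^ m * G := by
    calc 2 ^ m * ∫⁻ w, Y w ∂Q = ∑ τ : Fin m → Bool, ∫⁻ w, Y (swapPairs τ w) ∂Q := by
          rw [Finset.sum_congr rfl fun τ _ => (hswap τ).lintegral_comp hY]
          simp
      _ = ∫⁻ w, ∑ τ : Fin m → Bool, Y (swapPairs τ w) ∂Q :=
          (lintegral_finsetSum _ fun τ _ => hY.comp (hswap τ).measurable).symm
      _ ≤ ∫⁻ _, 2 ^ m * G ∂Q := lintegral_mono hsum
      _ = 2 ^ m * G := by simp [Q]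
  rw [hQ]
  exact (ENNReal.mul_le_mul_iff_right (by positivity) (by finiteness)).1 hint

/-! ### Monotonicity of the weights -/

lemma betaRem_nonneg (k m r : ℕ) : 0 ≤ betaRem k m r := by
  induction m generalizing r with
  | zero => rw [betaRem]; split_ifs <;> norm_num
  | succ m ih =>
    have h1 := ih r
    have h2 := ih (r + 1)
    simp only [betaRem, errStar]
    linarith

lemma betaRem_le_one (k m r : ℕ) : betaRem k m r ≤ 1 := by
  induction m generalizing r with
  | zero => rw [betaRem]; split_ifs <;> norm_num
  | succ m ih =>
    have h1 := ih r
    have h2 := ih (r + 1)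
    simp only [betaRem, errStar]
    linarith

lemma betaRem_succ_le (k m r : ℕ) : betaRem k m (r + 1) ≤ betaRem k m r := by
  induction m generalizing r with
  | zero =>
    simp only [betaRem, Nat.cast_add, Nat.cast_one]
    split_ifs with h1 h2 <;> linarith
  | succ m ih =>
    have h1 := ih r
    have h2 := ih (r + 1)
    simp only [betaRem, errStar]
    linarith

lemma alpha_nonneg (k j r : ℕ) : 0 ≤ alpha k j r :=
  sub_nonneg.2 (betaRem_succ_le k _ r)

lemma alpha_le_one (k j r : ℕ) : alpha k j r ≤ 1 := by
  have h1 := betaRem_le_one k (k - (j + 1)) r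
  have h2 := betaRem_nonneg k (k - (j + 1)) (r + 1)
  simp only [alpha, beta]
  linarith

lemma alpha_le_wMax {k j r : ℕ} (h : r ≤ j) : alpha k j r ≤ wMax k j :=
  Finset.le_sup' (alpha k j) (Finset.mem_range.2 (by omega))

lemma wMax_nonneg (k j : ℕ) : 0 ≤ wMax k j :=
  (alpha_nonneg k j 0).trans (alpha_le_wMax (Nat.zero_le j))

lemma wMax_le_one (k j : ℕ) : wMax k j ≤ 1 :=
  Finset.sup'_le _ _ fun r _ => alpha_le_one k j r

section
variable {Tok : Type*} {X : Set (Str Tok)} (V : X → Tok → Bool) (T k : ℕ) (ens : List (Model Tok))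

lemma rank_le_length (x : X) : rank V T ens x ≤ ens.length := by
  rw [rank]
  refine (List.sum_le_card_nsmul _ 1 fun i hi => ?_).trans (by simp)
  obtain ⟨π, -, rfl⟩ := List.mem_map.1 hi
  exact Bool.toNat_le _

/-- The probability with which `Sample` accepts the prompt `x`. -/
noncomputable def accProb (x : X) : ℝ :=
  alpha k ens.length (rank V T ens x) / wMax k ens.length

lemma accProb_nonneg (x : X) : 0 ≤ accProb V T k ens x :=
  div_nonneg (alpha_nonneg _ _ _) (wMax_nonneg _ _)

lemma accProb_le_one (x : X) : accProb V T k ens x ≤ 1 :=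
  div_le_one_of_le₀ (alpha_le_wMax (rank_le_length V T ens x)) (wMax_nonneg _ _)

lemma wMax_mul_accProb (x : X) :
    wMax k ens.length * accProb V T k ens x = alpha k ens.length (rank V T ens x) := by
  have h := alpha_le_wMax (k := k) (rank_le_length V T ens x)
  rcases (wMax_nonneg k ens.length).eq_or_lt with h0 | h0
  · rw [← h0] at h ⊢
    rw [zero_mul]
    exact le_antisymm (alpha_nonneg _ _ _) h
  · rw [accProb, mul_div_cancel₀ _ h0.ne']

end

/-! ### Measurability of ranks and votes -/

section Measurability
variable {Tok : Type*} {X : Set (Str Tok)} {Ω : Type*} [MeasurableSpace Ω]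

/-- The answer of the random model `M` on the random prompt `y` is measurable. -/
def MeasAnswer (T : ℕ) (M : Ω → Model Tok) (y : Ω → X) : Prop :=
  ∀ a, MeasurableSet {ω | answer (M ω) (y ω) T = a}

lemma MeasAnswer.comp {T : ℕ} {M : Ω → Model Tok} {y : Ω → X} (h : MeasAnswer T M y)
    {Ω' : Type*} [MeasurableSpace Ω'] {f : Ω' → Ω} (hf : Measurable f) :
    MeasAnswer T (fun ω => M (f ω)) (fun ω => y (f ω)) :=
  fun a => hf (h a)

variable [MeasurableSpace X]

lemma MeasAnswer.measurableSet_correct [Fintype Tok] {V : X → Tok → Bool}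
    (hV : ∀ a, MeasurableSet {x : X | V x a = true}) {T : ℕ} {M : Ω → Model Tok} {y : Ω → X}
    (hy : Measurable y) (h : MeasAnswer T M y) :
    MeasurableSet {ω | V (y ω) (answer (M ω) (y ω) T) = true} := by
  have : {ω | V (y ω) (answer (M ω) (y ω) T) = true} =
      ⋃ a, {ω | answer (M ω) (y ω) T = a} ∩ y ⁻¹' {x : X | V x a = true} := by
    ext ω
    simp
  rw [this]
  exact MeasurableSet.iUnion fun a => (h a).inter (hy (hV a))

lemma measurable_rank [Fintype Tok] {V : X → Tok → Bool}
    (hV : ∀ a, MeasurableSet {x : X | V x a = true}) {T : ℕ} {y : Ω → X} (hy : Measurable y)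
    (Ms : List (Ω → Model Tok)) (hMs : ∀ M ∈ Ms, MeasAnswer T M y) :
    Measurable fun ω => rank V T (Ms.map fun M => M ω) (y ω) := by
  induction Ms with
  | nil => exact measurable_const
  | cons M Ms ih =>
    simp only [rank, List.map_cons, List.sum_cons]
    refine Measurable.add ?_ (ih fun M' hM' => hMs M' (List.mem_cons_of_mem _ hM'))
    have hset := (hMs M List.mem_cons_self).measurableSet_correct hV hy
    have : (fun ω => (V (y ω) (answer (M ω) (y ω) T)).toNat) =
        Set.indicator {ω | V (y ω) (answer (M ω) (y ω) T) = true} fun _ => 1 := by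
      funext ω
      by_cases h : V (y ω) (answer (M ω) (y ω) T) = true <;> simp [h]
    rw [this]
    exact measurable_const.indicator hset

lemma measurable_accProb [Fintype Tok] {V : X → Tok → Bool}
    (hV : ∀ a, MeasurableSet {x : X | V x a = true}) {T : ℕ} (k : ℕ) {y : Ω → X}
    (hy : Measurable y) (Ms : List (Ω → Model Tok)) (hMs : ∀ M ∈ Ms, MeasAnswer T M y) :
    Measurable fun ω => accProb V T k (Ms.map fun M => M ω) (y ω) := by
  simp only [accProb, List.length_map]
  exact ((measurable_of_countable (alpha k Ms.length)).comp
    (measurable_rank hV hy Ms hMs)).div_const _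

end Measurability

/-! ### Rejection sampling -/

section Sampling
variable {Tok : Type*} {X : Set (Str Tok)} (V : X → Tok → Bool) (T k cap : ℕ)
  (ens : List (Model Tok))

lemma sampleLoop_cons (z : X × I) (l : List (X × I)) (s : SampleState X) :
    sampleLoop V T k cap ens (z :: l) s =
      if cap ≤ s.out.length then s
      else sampleLoop V T k cap ens l
        { out := if (z.2 : ℝ) ≤ accProb V T k ens z.1 then s.out ++ [z.1] else s.out
          graded := s.graded ++ [(z.1, ens.map fun π => answer π z.1 T)] } := by
  obtain ⟨x, η⟩ := z
  rfl

lemma sampleLoop_of_full (l : List (X × I)) {s : SampleState X} (h : cap ≤ s.out.length) :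
    sampleLoop V T k cap ens l s = s := by
  cases l with
  | nil => rfl
  | cons z l => rw [sampleLoop_cons, if_pos h]

variable [MeasurableSpace X]

lemma measurableSet_accept {q : X → ℝ} (hq : Measurable q) :
    MeasurableSet {z : X × I | (z.2 : ℝ) ≤ q z.1} :=
  measurableSet_le (measurable_subtype_coe.comp measurable_snd) (hq.comp measurable_fst)

/-- Chernoff bound for the event that too few prompts are accepted. -/
lemma iidE_sampleLoop_short (μ : Measure (X × I)) [IsProbabilityMeasure μ]
    (hq : Measurable (accProb V T k ens)) (b : ℕ) (s : SampleState X) :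
    iidE μ b (fun l => if (sampleLoop V T k cap ens l s).out.length < cap then 1 else 0) ≤
      2 ^ (cap - s.out.length) *
        (∫⁻ z, (if (z.2 : ℝ) ≤ accProb V T k ens z.1 then 2⁻¹ else 1) ∂μ) ^ b := by
  induction b generalizing s with
  | zero =>
    simp only [iidE, pow_zero, mul_one]
    change (if s.out.length < cap then (1 : ENNReal) else 0) ≤ _
    by_cases h : s.out.length < cap
    · rw [if_pos h]
      exact one_le_pow₀ (M₀ := ENNReal) one_le_two
    · rw [if_neg h]
      exact zero_le
  | succ b ih =>
    by_cases hs : cap ≤ s.out.length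
    · simp only [sampleLoop_of_full V T k cap ens _ hs, hs.not_gt, if_false, iidE_const]
      exact zero_le
    · simp only [iidE, sampleLoop_cons, if_neg hs]
      refine (lintegral_mono fun z => ih _).trans ?_
      rw [pow_succ', mul_left_comm, ← lintegral_mul_const _
        (Measurable.ite (measurableSet_accept hq) measurable_const measurable_const)]
      refine lintegral_mono fun z => ?_
      dsimp only
      rw [← mul_assoc]
      refine mul_le_mul_left ?_ _
      by_cases hz : (z.2 : ℝ) ≤ accProb V T k ens z.1
      · simp only [hz, if_true, List.length_append, List.length_singleton]
        have : cap - s.out.length = (cap - (s.out.length + 1)) + 1 := by omega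
        rw [this, pow_succ', ← mul_assoc, ENNReal.inv_mul_cancel (by norm_num) (by norm_num),
          one_mul]
      · simp only [hz, if_false, one_mul, le_refl]

/-- Accepted prompts are independent samples from the normalized acceptance density `D`: the
event that `cap` prompts are accepted and that their list satisfies a property is at most as likely
as that property is for a list of `cap` independent samples from `D`. -/
lemma iidE_sampleLoop_full (μ : Measure (X × I)) [IsProbabilityMeasure μ]
    (hq : Measurable (accProb V T k ens)) (D : Measure X) [IsProbabilityMeasure D] (p : ENNReal)
    (hD : ∀ φ : X → ENNReal, Measurable φ →
      ∫⁻ z in {z : X × I | (z.2 : ℝ) ≤ accProb V T k ens z.1}, φ z.1 ∂μ = p * ∫⁻ x, φ x ∂D)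
    {g : List X → ENNReal} (hg : ∀ m, Measurable fun v : Fin m → X => g (List.ofFn v))
    (b : ℕ) (s : SampleState X) :
    iidE μ b (fun l => if cap ≤ (sampleLoop V T k cap ens l s).out.length
        then g (sampleLoop V T k cap ens l s).out else 0) ≤
      iidE D (cap - s.out.length) fun l => g (s.out ++ l) := by
  induction b generalizing s with
  | zero =>
    change (if cap ≤ s.out.length then g s.out else 0) ≤ _
    by_cases h : cap ≤ s.out.length
    · rw [if_pos h]
      simp [Nat.sub_eq_zero_of_le h, iidE]
    · rw [if_neg h]
      exact zero_le
  | succ b ih =>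
    by_cases hs : cap ≤ s.out.length
    · simp only [sampleLoop_of_full V T k cap ens _ hs, hs, if_true, iidE_const,
        Nat.sub_eq_zero_of_le hs]
      simp [iidE]
    · simp only [iidE, sampleLoop_cons, if_neg hs]
      refine (lintegral_mono fun z => ih _).trans ?_
      have hA := measurableSet_accept hq
      set A := {z : X × I | (z.2 : ℝ) ≤ accProb V T k ens z.1} with hAdef
      obtain ⟨r, hr⟩ : ∃ r, cap - s.out.length = r + 1 := ⟨cap - s.out.length - 1, by omega⟩
      rw [← lintegral_add_compl _ hA]
      let φ : X → ENNReal := fun x => iidE D r fun l => g (s.out ++ x :: l)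
      have hφ : Measurable φ := by
        refine measurable_iidE D r ?_
        have hlist : ∀ p : X × (Fin r → X), s.out ++ p.1 :: List.ofFn p.2 =
            List.ofFn (n := s.out.length + (r + 1))
              (Fin.append s.out.get (Fin.cons p.1 p.2)) := by
          intro p
          rw [List.ofFn_fin_append, List.ofFn_get, List.ofFn_succ]
          simp
        simp only [hlist]
        refine (hg _).comp (measurable_pi_iff.2 fun i => ?_)
        refine Fin.addCases (fun i => ?_) (fun i => ?_) i
        · simp only [Fin.append_left]; exact measurable_const
        · simp only [Fin.append_right]
          refine Fin.cases ?_ (fun i => ?_) i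
          · simp only [Fin.cons_zero]; exact measurable_fst
          · simp only [Fin.cons_succ]; exact (measurable_pi_apply i).comp measurable_snd
      have h1 : ∫⁻ z in A, iidE D (cap - (if (z.2 : ℝ) ≤ accProb V T k ens z.1
          then s.out ++ [z.1] else s.out).length) (fun l => g ((if (z.2 : ℝ) ≤
            accProb V T k ens z.1 then s.out ++ [z.1] else s.out) ++ l)) ∂μ =
          p * ∫⁻ x, φ x ∂D := by
        rw [← hD φ hφ]
        refine setLIntegral_congr_fun hA fun z hz => ?_
        have hz' : (z.2 : ℝ) ≤ accProb V T k ens z.1 := hz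
        have hr' : cap - (s.out.length + 1) = r := by omega
        simp [hz', hr', φ]
      have h2 : ∫⁻ z in Aᶜ, iidE D (cap - (if (z.2 : ℝ) ≤ accProb V T k ens z.1
          then s.out ++ [z.1] else s.out).length) (fun l => g ((if (z.2 : ℝ) ≤
            accProb V T k ens z.1 then s.out ++ [z.1] else s.out) ++ l)) ∂μ =
          (∫⁻ x, φ x ∂D) * μ Aᶜ := by
        rw [← setLIntegral_const]
        refine setLIntegral_congr_fun hA.compl fun z hz => ?_
        have hz' : ¬ (z.2 : ℝ) ≤ accProb V T k ens z.1 := hz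
        simp only [hz', if_false, hr]
        rfl
      have hp : μ A = p := by
        have := hD (fun _ => 1) measurable_const
        simpa using this
      have h3 : iidE D (cap - s.out.length) (fun l => g (s.out ++ l)) = ∫⁻ x, φ x ∂D := by
        rw [hr]; rfl
      refine le_of_eq ?_
      refine (congrArg₂ (· + ·) h1 h2).trans ?_
      rw [h3, mul_comm p, ← mul_add, ← hp, measure_add_measure_compl hA, measure_univ, mul_one]

/-- Accepting `x` when an independent uniform variable is at most `q x` has density `q`. -/
lemma lintegral_accept (ρ : Measure X) [IsProbabilityMeasure ρ] {q : X → ℝ} (hq : Measurable q)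
    (h0 : ∀ x, 0 ≤ q x) (h1 : ∀ x, q x ≤ 1) {φ : X → ENNReal} (hφ : Measurable φ) :
    ∫⁻ z in {z : X × I | (z.2 : ℝ) ≤ q z.1}, φ z.1 ∂(ρ.prod (volume : Measure I)) =
      ∫⁻ x, ENNReal.ofReal (q x) * φ x ∂ρ := by
  have hA := measurableSet_accept hq
  have hind : Measurable (Set.indicator {z : X × I | (z.2 : ℝ) ≤ q z.1} fun z => φ z.1) :=
    (hφ.comp measurable_fst).indicator hA
  rw [← lintegral_indicator hA, lintegral_prod _ hind.aemeasurable]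
  refine lintegral_congr fun x => ?_
  have : (fun η : I => Set.indicator {z : X × I | (z.2 : ℝ) ≤ q z.1} (fun z => φ z.1) (x, η)) =
      Set.indicator (Set.Iic (⟨q x, h0 x, h1 x⟩ : I)) fun _ => φ x := by
    funext η
    have : (η : ℝ) ≤ q x ↔ η ∈ Set.Iic (⟨q x, h0 x, h1 x⟩ : I) := Iff.rfl
    by_cases h : (η : ℝ) ≤ q x
    · rw [Set.indicator_of_mem (this.1 h), Set.indicator_of_mem (by exact h)]
    · rw [Set.indicator_of_notMem (fun h' => h (this.2 h')),
        Set.indicator_of_notMem (by exact h)]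
  rw [this, lintegral_indicator measurableSet_Iic, setLIntegral_const, unitInterval.volume_Iic,
    mul_comm]

end Sampling

/-! ### The boost-by-majority potential -/

lemma beta_eq {k j : ℕ} (hj : j < k) (r : ℕ) :
    beta k j r = errStar * beta k (j + 1) r + (1 - errStar) * beta k (j + 1) (r + 1) := by
  have : k - j = (k - (j + 1)) + 1 := by omega
  simp only [beta, this, betaRem]

/-- Markov's inequality for `3 ^ (-r)`, whose mean is multiplied by `1/4 + (3/4) (1/3) = 1/2` in
each phase. -/
lemma betaRem_le (k m r : ℕ) : betaRem k m r ≤ √3 ^ k * (1 / 3) ^ r * (1 / 2) ^ m := by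
  induction m generalizing r with
  | zero =>
    rw [betaRem, pow_zero, mul_one]
    split_ifs with h
    · have h2 : r * 2 ≤ k := by
        have : (r : ℝ) * 2 ≤ k := by linarith
        exact_mod_cast this
      have h3 : (3 : ℝ) ^ r ≤ √3 ^ k := by
        calc (3 : ℝ) ^ r = √3 ^ (2 * r) := by rw [pow_mul, Real.sq_sqrt (by norm_num)]
          _ ≤ √3 ^ k := pow_le_pow_right₀ (by rw [Real.one_le_sqrt]; norm_num) (by omega)
      rw [one_div, inv_pow, ← div_eq_mul_inv, one_le_div (by positivity)]
      exact h3
    · positivity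
  | succ m ih =>
    have h1 := ih r
    have h2 := ih (r + 1)
    simp only [betaRem, errStar]
    have e : √3 ^ k * (1 / 3) ^ r * (1 / 2) ^ (m + 1) =
        1 / 4 * (√3 ^ k * (1 / 3) ^ r * (1 / 2) ^ m) +
          (1 - 1 / 4) * (√3 ^ k * (1 / 3) ^ (r + 1) * (1 / 2) ^ m) := by ring
    rw [e]
    linarith

lemma sq_beta_zero_le (k : ℕ) : beta k 0 0 ^ 2 ≤ (3 / 4) ^ k := by
  have h := betaRem_le k k 0
  have h0 := betaRem_nonneg k k 0
  calc beta k 0 0 ^ 2 ≤ (√3 ^ k * (1 / 3) ^ 0 * (1 / 2) ^ k) ^ 2 := by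
        simp only [beta, Nat.sub_zero]
        gcongr
    _ = (√3 ^ 2) ^ k * (1 / 4) ^ k := by
        rw [pow_zero, mul_one, mul_pow, ← pow_mul, ← pow_mul, ← pow_mul, mul_comm k 2, pow_mul,
          pow_mul (1 / 2 : ℝ)]
        norm_num
    _ = (3 / 4) ^ k := by
        rw [Real.sq_sqrt (by norm_num), ← mul_pow]
        norm_num

lemma beta_zero_le {k : ℕ} (hk : 1 ≤ k) : beta k 0 0 ≤ 9 / 16 := by
  rcases lt_or_ge k 4 with h | h
  · interval_cases k <;> norm_num [beta, betaRem, errStar]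
  · have h1 := sq_beta_zero_le k
    have h2 : (3 / 4 : ℝ) ^ k ≤ (3 / 4) ^ 4 :=
      pow_le_pow_of_le_one (by norm_num) (by norm_num) h
    have h3 : beta k 0 0 ^ 2 ≤ (9 / 16) ^ 2 := by
      refine (h1.trans h2).trans_eq ?_
      norm_num
    exact le_of_sq_le_sq h3 (by norm_num)

lemma le_numPhases {C ε : ℝ} : 16 * (C * Real.log (1 / ε)) ≤ numPhases C ε := by
  refine le_trans (le_of_eq ?_) (Nat.le_ceil _)
  rw [errStar]
  ring

lemma one_le_numPhases {C ε : ℝ} (hC : 0 < C) (h0 : 0 < ε) (h1 : ε < 1) :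
    1 ≤ numPhases C ε := by
  have hl : 0 < Real.log (1 / ε) := Real.log_pos (one_lt_one_div h0 h1)
  exact Nat.ceil_pos.2 (by rw [errStar]; positivity)

/-- The initial potential is smaller than `ε`, also when `ε` is close to `1` and there are few
phases. -/
lemma beta_numPhases_le {C ε : ℝ} (hC : 1 ≤ C) (h0 : 0 < ε) (h1 : ε < 1) :
    beta (numPhases C ε) 0 0 ≤ 3 / 4 * ε := by
  rcases lt_or_ge (3 / 4) ε with h | h
  · have := beta_zero_le (one_le_numPhases (C := C) (by linarith) h0 h1)
    linarith
  · have hl : 0 < Real.log (1 / ε) := Real.log_pos (one_lt_one_div h0 h1)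
    have hk : 16 * Real.log (1 / ε) ≤ numPhases C ε := by
      refine le_trans ?_ (le_numPhases (C := C))
      nlinarith
    set k := numPhases C ε
    have h2 : (3 / 4 : ℝ) ^ k ≤ ε ^ 4 := by
      calc (3 / 4 : ℝ) ^ k ≤ (Real.exp (-(1 / 4))) ^ k := by
            gcongr
            have := Real.add_one_le_exp (-(1 / 4) : ℝ)
            linarith
        _ = Real.exp (-(k / 4)) := by rw [← Real.exp_nat_mul]; congr 1; ring
        _ ≤ Real.exp (4 * Real.log ε) := by
            rw [one_div, Real.log_inv] at hk
            exact Real.exp_le_exp.2 (by linarith)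
        _ = ε ^ 4 := by
            rw [mul_comm, Real.exp_mul, Real.exp_log h0]
            norm_cast
    have h3 : beta k 0 0 ^ 2 ≤ (ε ^ 2) ^ 2 := by
      refine (sq_beta_zero_le k).trans (h2.trans (le_of_eq ?_))
      ring
    have h4 : beta k 0 0 ≤ ε ^ 2 := le_of_sq_le_sq h3 (by positivity)
    nlinarith

section Potential
variable {Tok : Type*} {X : Set (Str Tok)} (V : X → Tok → Bool) (T k : ℕ)

lemma rank_append (ens : List (Model Tok)) (π : Model Tok) (x : X) :
    rank V T (ens ++ [π]) x = rank V T ens x + (V x (answer π x T)).toNat := by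
  simp [rank]

variable [MeasurableSpace X]

/-- The probability that a prompt drawn from `ρ` lies in `S` and is accepted against `ens`. -/
noncomputable def acceptMass (ρ : Measure X) (ens : List (Model Tok)) (S : Set X) : ENNReal :=
  ∫⁻ x, S.indicator (fun x => ENNReal.ofReal (accProb V T k ens x)) x ∂ρ

/-- The prompts that the model `π` answers wrongly. -/
def wrongSet (π : Model Tok) : Set X := {x | V x (answer π x T) = false}

/-- The phase with training result `π` fails: a prompt is accepted with probability above `θ`, and
nevertheless `π` errs on more than a quarter of the accepted prompts. -/
def PhaseFails (ρ : Measure X) (θ : ENNReal) (ens : List (Model Tok)) (π : Model Tok) : Prop :=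
  θ < acceptMass V T k ρ ens Set.univ ∧
    acceptMass V T k ρ ens Set.univ < 4 * acceptMass V T k ρ ens (wrongSet V T π)

/-- The mean of the weights `β` at the current ranks, an upper bound for the error that the final
vote will have if all later models have error `errStar`. -/
noncomputable def potential (ρ : Measure X) (ens : List (Model Tok)) : ℝ :=
  ∫ x, beta k ens.length (rank V T ens x) ∂ρ

variable [Fintype Tok] {V} {T}

lemma measurable_rank_const (hV : ∀ a, MeasurableSet {x : X | V x a = true})
    {ens : List (Model Tok)} (hens : ∀ π ∈ ens, MeasAnswer T (fun _ : X => π) id) :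
    Measurable (rank V T ens) := by
  have := measurable_rank hV measurable_id (ens.map fun π (_ : X) => π) (by
    simpa using hens)
  simpa [List.map_map, Function.comp_def] using this

lemma measurable_accProb_const (hV : ∀ a, MeasurableSet {x : X | V x a = true})
    {ens : List (Model Tok)} (hens : ∀ π ∈ ens, MeasAnswer T (fun _ : X => π) id) :
    Measurable (accProb V T k ens) :=
  ((measurable_of_countable (alpha k ens.length)).comp
    (measurable_rank_const hV hens)).div_const _

lemma integrable_beta_rank (j : ℕ) (ρ : Measure X) [IsProbabilityMeasure ρ]
    (hV : ∀ a, MeasurableSet {x : X | V x a = true})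
    {ens : List (Model Tok)} (hens : ∀ π ∈ ens, MeasAnswer T (fun _ : X => π) id) :
    Integrable (fun x => beta k j (rank V T ens x)) ρ := by
  refine Integrable.of_bound ((measurable_of_countable (beta k j)).comp
    (measurable_rank_const hV hens)).aestronglyMeasurable 1
    (Filter.Eventually.of_forall fun x => ?_)
  rw [beta, Real.norm_of_nonneg (betaRem_nonneg _ _ _)]
  exact betaRem_le_one _ _ _

lemma measurableSet_wrongSet (hV : ∀ a, MeasurableSet {x : X | V x a = true}) {π : Model Tok}
    (hπ : MeasAnswer T (fun _ : X => π) id) : MeasurableSet (wrongSet (X := X) V T π) := by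
  have := (hπ.measurableSet_correct hV measurable_id).compl
  convert this using 1
  ext x
  simp [wrongSet]

/-- A phase that does not fail increases the potential by at most the threshold. -/
lemma potential_append_le (ρ : Measure X) [IsProbabilityMeasure ρ]
    (hV : ∀ a, MeasurableSet {x : X | V x a = true})
    {ens : List (Model Tok)} (hens : ∀ π ∈ ens, MeasAnswer T (fun _ : X => π) id)
    {π : Model Tok} (hπ : MeasAnswer T (fun _ : X => π) id) (hk : ens.length < k) {θ : ℝ}
    (hθ : 0 ≤ θ) (hok : ¬ PhaseFails V T k ρ (ENNReal.ofReal θ) ens π) :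
    potential V T k ρ (ens ++ [π]) ≤ potential V T k ρ ens + θ := by
  have hW := measurableSet_wrongSet hV hπ
  set W : Set X := wrongSet V T π with hWdef
  set j := ens.length with hj
  set q := accProb V T k ens with hqdef
  set M := wMax k j with hM
  have hM0 : 0 ≤ M := wMax_nonneg k j
  have hM1 : M ≤ 1 := wMax_le_one k j
  have hq : Measurable q := measurable_accProb_const k hV hens
  have hq0 : ∀ x, 0 ≤ q x := accProb_nonneg V T k ens
  have hq1 : ∀ x, q x ≤ 1 := accProb_le_one V T k ens
  have hqi : Integrable q ρ := by
    refine Integrable.of_bound hq.aestronglyMeasurable 1 (Filter.Eventually.of_forall fun x => ?_)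
    rw [Real.norm_of_nonneg (hq0 x)]
    exact hq1 x
  have hqW : Integrable (W.indicator q) ρ := hqi.indicator hW
  have hbi : Integrable (fun x => beta k j (rank V T ens x)) ρ :=
    integrable_beta_rank k j ρ hV hens
  have hpt : ∀ x, beta k (ens ++ [π]).length (rank V T (ens ++ [π]) x) =
      beta k j (rank V T ens x) + M * (W.indicator q x - 1 / 4 * q x) := by
    intro x
    have hw := wMax_mul_accProb V T k ens x
    rw [← hj, ← hM, ← hqdef, alpha] at hw
    rw [beta_eq hk, rank_append, List.length_append, List.length_singleton, ← hj, errStar]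
    by_cases hx : V x (answer π x T) = true
    · have hxW : x ∉ W := by simp [hWdef, wrongSet, hx]
      rw [Set.indicator_of_notMem hxW, hx]
      simp only [Bool.toNat_true]
      linear_combination (1 / 4) * hw
    · have hxW : x ∈ W := by simpa [hWdef, wrongSet] using hx
      rw [Set.indicator_of_mem hxW, Bool.eq_false_of_not_eq_true hx]
      simp only [Bool.toNat_false, add_zero]
      linear_combination (-(3 / 4)) * hw
  have hint : potential V T k ρ (ens ++ [π]) =
      potential V T k ρ ens + M * (∫ x, W.indicator q x ∂ρ - 1 / 4 * ∫ x, q x ∂ρ) := by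
    have hd : Integrable (fun x => W.indicator q x - 1 / 4 * q x) ρ := hqW.sub (hqi.const_mul _)
    simp only [potential, hpt]
    rw [integral_add hbi (hd.const_mul M), integral_const_mul,
      integral_sub hqW (hqi.const_mul _), integral_const_mul]
  have hA : acceptMass V T k ρ ens Set.univ = ENNReal.ofReal (∫ x, q x ∂ρ) := by
    rw [ofReal_integral_eq_lintegral_ofReal hqi (Filter.Eventually.of_forall hq0)]
    simp [acceptMass, hqdef]
  have hWn : ∀ x, 0 ≤ W.indicator q x := fun x => Set.indicator_nonneg (fun x _ => hq0 x) x
  have hB : acceptMass V T k ρ ens W = ENNReal.ofReal (∫ x, W.indicator q x ∂ρ) := by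
    rw [ofReal_integral_eq_lintegral_ofReal hqW (Filter.Eventually.of_forall hWn)]
    refine lintegral_congr fun x => ?_
    by_cases hx : x ∈ W <;> simp [hx, hqdef]
  have ha0 : 0 ≤ ∫ x, q x ∂ρ := integral_nonneg hq0
  have hb0 : 0 ≤ ∫ x, W.indicator q x ∂ρ := integral_nonneg hWn
  have hba : ∫ x, W.indicator q x ∂ρ ≤ ∫ x, q x ∂ρ :=
    integral_mono hqW hqi fun x => Set.indicator_le_self' (fun x _ => hq0 x) x
  rw [PhaseFails, not_and_or, not_lt, not_lt, hA, hB] at hok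
  rw [hint]
  rcases hok with h | h
  · rw [ENNReal.ofReal_le_ofReal_iff hθ] at h
    nlinarith
  · rw [show (4 : ENNReal) = ENNReal.ofReal 4 by norm_num, ← ENNReal.ofReal_mul (by norm_num),
      ENNReal.ofReal_le_ofReal_iff ha0] at h
    nlinarith

/-! ### From the potential to the accuracy of the vote -/

omit [MeasurableSpace X] [Fintype Tok] in
/-- An answer that more than half of the models give wins the vote. -/
lemma vote_correct [DecidableEq Tok] (hs : Sparse V) {plu : List Tok → Tok}
    (hplu : IsPlurality plu) {ens : List (Model Tok)} {x : X}
    (h : ens.length < 2 * rank V T ens x) : V x (vote plu T ens x) = true := by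
  obtain ⟨a, ha, hu⟩ := hs x
  set l := ens.map fun π => answer π x T with hl
  have hc : ∀ ens : List (Model Tok),
      (ens.map fun π => answer π x T).count a = rank V T ens x := by
    intro ens
    induction ens with
    | nil => rfl
    | cons π ens ih =>
      rw [List.map_cons, List.count_cons, ih, rank, rank, List.map_cons, List.sum_cons, add_comm]
      congr 1
      by_cases hx : answer π x T = a
      · simp [hx, ha]
      · have : V x (answer π x T) = false :=
          Bool.eq_false_of_not_eq_true fun h' => hx (hu _ h')
        simp [hx, this]
  have hne : l ≠ [] := by
    rintro h0
    have h1 := hc ens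
    rw [← hl, h0, List.count_nil] at h1
    omega
  have hp := hplu l hne a
  have hva : plu l = a := by
    by_contra hva
    have h1 : l.count a + l.count (plu l) ≤ l.length := by
      have h2 := List.length_eq_countP_add_countP (· == a) (l := l)
      have h3 : l.count (plu l) ≤ l.countP (fun b => ¬ (b == a) = true) := by
        refine List.countP_mono_left fun b _ hb => ?_
        have : b = plu l := by simpa using hb
        simp [this, hva]
      have h4 : l.count a = l.countP (· == a) := rfl
      rw [← h4] at h2
      omega
    have h4 := hc ens
    rw [← hl] at h4
    have h5 : l.length = ens.length := by simp [hl]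
    omega
  rw [vote, ← hl, hva, ha]

lemma measurableSet_vote_correct (hV : ∀ a, MeasurableSet {x : X | V x a = true})
    (plu : List Tok → Tok) {ens : List (Model Tok)}
    (hens : ∀ π ∈ ens, MeasAnswer T (fun _ : X => π) id) :
    MeasurableSet {x : X | V x (vote plu T ens x) = true} := by
  have hl : ∀ l : List Tok, MeasurableSet {x : X | (ens.map fun π => answer π x T) = l} := by
    clear * - hens
    induction ens with
    | nil => intro l; exact MeasurableSet.const ([] = l)
    | cons π ens ih =>
      intro l
      cases l with
      | nil => simp
      | cons a l =>
        simp only [List.map_cons, List.cons.injEq]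
        exact (hens π List.mem_cons_self a).inter
          (ih (fun π' h => hens π' (List.mem_cons_of_mem _ h)) l)
  have : {x : X | V x (vote plu T ens x) = true} =
      ⋃ l : List Tok, {x : X | (ens.map fun π => answer π x T) = l} ∩
        {x | V x (plu l) = true} := by
    ext x
    simp [vote]
  rw [this]
  exact MeasurableSet.iUnion fun l => (hl l).inter (hV _)

lemma one_sub_potential_le_acc [DecidableEq Tok] (ρ : Measure X) [IsProbabilityMeasure ρ]
    (hV : ∀ a, MeasurableSet {x : X | V x a = true}) (hs : Sparse V) {plu : List Tok → Tok}
    (hplu : IsPlurality plu) {ens : List (Model Tok)}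
    (hens : ∀ π ∈ ens, MeasAnswer T (fun _ : X => π) id) (hk : ens.length = k) :
    1 - potential V T k ρ ens ≤ acc ρ V (vote plu T ens) := by
  have hset := measurableSet_vote_correct hV plu hens
  have hbi := integrable_beta_rank k ens.length ρ hV hens
  have h1 : 1 - potential V T k ρ ens =
      ∫ x, (1 - beta k ens.length (rank V T ens x)) ∂ρ := by
    rw [integral_sub (integrable_const _) hbi, potential]
    simp
  rw [h1, acc]
  refine integral_mono ((integrable_const _).sub hbi) ?_ fun x => ?_
  · refine Integrable.of_bound
      (Measurable.ite hset measurable_const measurable_const).aestronglyMeasurable 1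
      (Filter.Eventually.of_forall fun x => ?_)
    split_ifs <;> norm_num
  · dsimp only
    by_cases hx : V x (vote plu T ens x) = true
    · rw [if_pos hx]
      have := betaRem_nonneg k (k - ens.length) (rank V T ens x)
      rw [beta]
      linarith
    · rw [if_neg hx]
      have hr : 2 * rank V T ens x ≤ ens.length := by
        by_contra h
        exact hx (vote_correct hs hplu (by omega))
      have hr' : (rank V T ens x : ℝ) ≤ k / 2 := by
        have : (2 * rank V T ens x : ℝ) ≤ k := by rw [← hk]; exact_mod_cast hr
        linarith
      rw [beta, hk, Nat.sub_self, betaRem, if_pos hr', sub_self]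

end Potential

/-! ### The base learner on independent prompts -/

section Learner
variable {Tok : Type*} [Fintype Tok] {X : Set (Str Tok)} [MeasurableSpace X] {T : ℕ}
  {πs : Model Tok} {ntp : CoTData X T → Model Tok}

lemma measurableSet_answer_oracle (hT : 1 ≤ T)
    (hcot : ∀ y, MeasurableSet {x : X | cot πs x T = y}) :
    MeasAnswer T (fun _ : X => πs) id := by
  intro a
  have : {x : X | answer πs x T = a} =
      ⋃ y : {y : Fin T → Tok // y ⟨T - 1, by omega⟩ = a}, {x : X | cot πs x T = y} := by
    ext x
    simp [answer_eq_cot πs _ hT]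
  simp only [id]
  rw [this]
  have : Finite {y : Fin T → Tok // y ⟨T - 1, by omega⟩ = a} := Subtype.finite
  exact MeasurableSet.iUnion fun y => hcot _

/-- The model trained on finitely many random prompts has measurable answers. -/
lemma MeasurableLearner.measAnswer (hntp : MeasurableLearner ntp)
    (hcot : ∀ y, MeasurableSet {x : X | cot πs x T = y}) {Ω : Type*} [MeasurableSpace Ω]
    (us : List (Ω → X)) (hus : ∀ u ∈ us, Measurable u) {y : Ω → X} (hy : Measurable y) :
    MeasAnswer T (fun ω => ntp ((us.map fun u => u ω).map fun x => (x, cot πs x T))) y := by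
  intro a
  have hlist : ∀ ω, ((us.map fun u => u ω).map fun x : X => (x, cot πs x T)) =
      List.ofFn fun i => (us.get i ω, cot πs (us.get i ω) T) := by
    intro ω
    rw [List.map_map, ← List.ofFn_get us, List.map_ofFn]
    simp [Function.comp_def]
  have : {ω | answer (ntp ((us.map fun u => u ω).map fun x => (x, cot πs x T))) (y ω) T = a} =
      ⋃ c : Fin us.length → Fin T → Tok,
        (⋂ i, us.get i ⁻¹' {x : X | cot πs x T = c i}) ∩
        (fun ω => ((fun i => us.get i ω), y ω)) ⁻¹'
          {p : (Fin us.length → X) × X |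
            answer (ntp (List.ofFn fun i => (p.1 i, c i))) p.2 T = a} := by
    ext ω
    simp only [hlist, Set.mem_ofPred_eq, Set.mem_iUnion, Set.mem_inter_iff, Set.mem_iInter,
      Set.mem_preimage]
    constructor
    · intro h
      exact ⟨fun i => cot πs (us.get i ω) T, fun i => rfl, h⟩
    · rintro ⟨c, hc, h⟩
      simp only [hc]
      exact h
  rw [this]
  refine MeasurableSet.iUnion fun c => (MeasurableSet.iInter fun i => ?_).inter ?_
  · exact hus _ (List.get_mem us i) (hcot _)
  · exact (Measurable.prodMk (measurable_pi_iff.2 fun i => hus _ (List.get_mem us i)) hy)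
      (hntp _ c a)

omit [Fintype Tok] in
lemma MeasurableLearner.measAnswer_const (hntp : MeasurableLearner ntp) (D : CoTData X T) :
    MeasAnswer T (fun _ : X => ntp D) id := by
  intro a
  have h := hntp D.length (fun i => (D.get i).2) a
  have hD : (List.ofFn fun i => ((D.get i).1, (D.get i).2)) = D := List.ofFn_get D
  have h2 := (measurable_prodMk_left (x := fun i => (D.get i).1)) h
  simp only [Set.preimage_ofPred_eq, hD] at h2
  exact h2

lemma MeasurableLearner.measurableSet_error (hT : 1 ≤ T) (hmeas : MeasurableLearner ntp)
    (hcot : ∀ y, MeasurableSet {x : X | cot πs x T = y}) (m : ℕ) :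
    MeasurableSet {p : (Fin m → X) × X |
      answer (ntp ((List.ofFn p.1).map fun x => (x, cot πs x T))) p.2 T ≠ answer πs p.2 T} := by
  have h1 := hmeas.measAnswer (Ω := (Fin m → X) × X) hcot
    (List.ofFn fun (i : Fin m) (p : (Fin m → X) × X) => p.1 i)
    (by
      intro u hu
      obtain ⟨i, rfl⟩ := (List.mem_ofFn' _ _).1 hu
      exact (measurable_pi_apply i).comp measurable_fst) measurable_snd
  simp only [List.map_ofFn, Function.comp_def] at h1
  have h2 := (measurableSet_answer_oracle hT hcot).comp
    (measurable_snd (α := Fin m → X) (β := X))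
  have : {p : (Fin m → X) × X |
      answer (ntp ((List.ofFn p.1).map fun x => (x, cot πs x T))) p.2 T ≠ answer πs p.2 T} =
      ⋃ a, {p : (Fin m → X) × X | answer (ntp (List.ofFn fun i =>
        (p.1 i, cot πs (p.1 i) T))) p.2 T = a} ∩ {p | answer πs p.2 T = a}ᶜ := by
    ext p
    simp [Function.comp_def, eq_comm]
  rw [this]
  exact MeasurableSet.iUnion fun a => (h1 a).inter (h2 a).compl

/-- A next-token-prediction learner that is trained on `m` independent prompts from `D`, labelled
by a member of the class, rarely has error above `1/4`. -/
lemma IsNTP.prob_large_error_le [DecidableEq Tok] (hT : 1 ≤ T) {H : Set (Model Tok)} {d : ℕ}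
    (hd : Ndim H = d) (hπ : πs ∈ H) (hntp : IsNTP H ntp) (hmeas : MeasurableLearner ntp)
    (hcot : ∀ y, MeasurableSet {x : X | cot πs x T = y}) (D : Measure X) [IsProbabilityMeasure D]
    (m : ℕ) {z : ℝ} (hz : 0 < z) (hz1 : z ≤ 1) :
    (Measure.pi fun _ : Fin m => D) {v | 1 / 4 < D {x : X |
        answer (ntp ((List.ofFn v).map fun x => (x, cot πs x T))) x T ≠ answer πs x T}} *
      (5 / 4) ^ m ≤
    ENNReal.ofReal ((z⁻¹) ^ d * (1 + (Fintype.card Tok : ℝ) ^ 2 * z) ^ (2 * m * T)) := by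
  classical
  let E : Set ((Fin m → X) × X) := {p |
    answer (ntp ((List.ofFn p.1).map fun x => (x, cot πs x T))) p.2 T ≠ answer πs p.2 T}
  have hE : MeasurableSet E := hmeas.measurableSet_error hT hcot m
  refine AutoTune.prob_large_error_le D hE fun w => ?_
  let P : Finset (Str Tok) := (Finset.univ.image fun i => ((w i).1 : Str Tok)) ∪
    Finset.univ.image fun i => ((w i).2 : Str Tok)
  have hP : P.card ≤ 2 * m := by
    refine (Finset.card_union_le _ _).trans ?_
    have h1 : (Finset.univ.image fun i => ((w i).1 : Str Tok)).card ≤ m :=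
      Finset.card_image_le.trans (by simp)
    have h2 : (Finset.univ.image fun i => ((w i).2 : Str Tok)).card ≤ m :=
      Finset.card_image_le.trans (by simp)
    omega
  obtain ⟨R, hR, hc⟩ := exists_deviation_cover hd πs T hz hz1 P hP
  refine ⟨R.image fun r => {x : X | Deviates πs T r x}, ?_, fun τ => ?_⟩
  · rw [← ENNReal.ofReal_natCast]
    refine ENNReal.ofReal_le_ofReal (le_trans ?_ hR)
    exact_mod_cast Finset.card_image_le
  · set v : Fin m → X := fun i => (swapPairs τ w i).1 with hv
    obtain ⟨r, hr, hrP⟩ := hc _ (hntp ((List.ofFn v).map fun x => (x, cot πs x T))).1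
    have hmem : ∀ i, ((swapPairs τ w i).1 : Str Tok) ∈ P ∧
        ((swapPairs τ w i).2 : Str Tok) ∈ P := by
      intro i
      have h1 : ((w i).1 : Str Tok) ∈ P :=
        Finset.mem_union_left _ (Finset.mem_image_of_mem _ (Finset.mem_univ i))
      have h2 : ((w i).2 : Str Tok) ∈ P :=
        Finset.mem_union_right _ (Finset.mem_image_of_mem _ (Finset.mem_univ i))
      by_cases h : τ i
      · simpa [swapPairs, h] using ⟨h2, h1⟩
      · simpa [swapPairs, h] using ⟨h1, h2⟩
    refine ⟨_, Finset.mem_image_of_mem _ hr, fun i hi => ?_, fun i hi => ?_⟩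
    · refine hntp.not_deviates hT hπ (List.ofFn v) (x := v i) ?_ ((hrP _ (hmem i).1).1 hi)
      exact (List.mem_ofFn' _ _).2 ⟨i, rfl⟩
    · exact (hrP _ (hmem i).2).2 (Deviates.of_answer_ne hT hi)

end Learner

/-! ### Measurability of a phase -/

section Phase
variable {Tok : Type*} [Fintype Tok] {X : Set (Str Tok)} [MeasurableSpace X] {V : X → Tok → Bool}
  {T : ℕ} {Ω : Type*} [MeasurableSpace Ω]

/-- Properties of the accepted prompts are measurable: along each sequence of acceptances and
rejections the accepted prompts are a fixed list of measurable functions. -/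
lemma measurableSet_sampleLoop (hV : ∀ a, MeasurableSet {x : X | V x a = true}) (k cap : ℕ)
    (Ms : List (Ω → Model Tok)) (zs : List (Ω → X × I)) (hzs : ∀ z ∈ zs, Measurable z)
    (hMs : ∀ M ∈ Ms, ∀ z ∈ zs, MeasAnswer T M fun ω => (z ω).1)
    {Q : Ω → List X → Prop}
    (hQ : ∀ us : List (Ω → X), (∀ u ∈ us, Measurable u) →
      MeasurableSet {ω | Q ω (us.map fun u => u ω)})
    (us : List (Ω → X)) (hus : ∀ u ∈ us, Measurable u) (gr : Ω → List (X × List Tok)) :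
    MeasurableSet {ω | Q ω (sampleLoop V T k cap (Ms.map fun M => M ω) (zs.map fun z => z ω)
      ⟨us.map fun u => u ω, gr ω⟩).out} := by
  induction zs generalizing us gr with
  | nil => exact hQ us hus
  | cons z zs ih =>
    by_cases hcap : cap ≤ us.length
    · have : ∀ ω, sampleLoop V T k cap (Ms.map fun M => M ω) ((z :: zs).map fun z => z ω)
          ⟨us.map fun u => u ω, gr ω⟩ = ⟨us.map fun u => u ω, gr ω⟩ :=
        fun ω => sampleLoop_of_full V T k cap _ _ (by simpa using hcap)
      simp only [this]
      exact hQ us hus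
    have hz : Measurable z := hzs z List.mem_cons_self
    set A : Set Ω := {ω | ((z ω).2 : ℝ) ≤ accProb V T k (Ms.map fun M => M ω) (z ω).1} with hA
    have hAm : MeasurableSet A :=
      measurableSet_le (measurable_subtype_coe.comp (measurable_snd.comp hz))
        (measurable_accProb hV k (measurable_fst.comp hz) Ms
          fun M hM => hMs M hM z List.mem_cons_self)
    have ih' := ih (fun z' h => hzs z' (List.mem_cons_of_mem _ h))
      (fun M hM z' h => hMs M hM z' (List.mem_cons_of_mem _ h))
    let gr' : Ω → List (X × List Tok) := fun ω =>
      gr ω ++ [((z ω).1, (Ms.map fun M => M ω).map fun π => answer π (z ω).1 T)]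
    have h1 := ih' (us ++ [fun ω => (z ω).1]) (by
      intro u hu
      rcases List.mem_append.1 hu with hu | hu
      · exact hus u hu
      · rw [List.mem_singleton.1 hu]; exact measurable_fst.comp hz) gr'
    have h2 := ih' us hus gr'
    have : {ω | Q ω (sampleLoop V T k cap (Ms.map fun M => M ω) ((z :: zs).map fun z => z ω)
        ⟨us.map fun u => u ω, gr ω⟩).out} =
        (A ∩ {ω | Q ω (sampleLoop V T k cap (Ms.map fun M => M ω) (zs.map fun z => z ω)
          ⟨(us ++ [fun ω => (z ω).1]).map fun u => u ω, gr' ω⟩).out}) ∪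
        (Aᶜ ∩ {ω | Q ω (sampleLoop V T k cap (Ms.map fun M => M ω) (zs.map fun z => z ω)
          ⟨us.map fun u => u ω, gr' ω⟩).out}) := by
      ext ω
      simp only [Set.mem_union, Set.mem_inter_iff, Set.mem_compl_iff, Set.mem_ofPred_eq,
        List.map_cons, sampleLoop_cons, List.length_map, if_neg hcap]
      by_cases h : ω ∈ A
      · have h' : ((z ω).2 : ℝ) ≤ accProb V T k (Ms.map fun M => M ω) (z ω).1 := h
        simp [h, h', gr']
      · have h' : ¬ ((z ω).2 : ℝ) ≤ accProb V T k (Ms.map fun M => M ω) (z ω).1 := h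
        simp only [h, if_neg h', not_false_eq_true, true_and, false_and, false_or]
        rfl
    rw [this]
    exact (hAm.inter h1).union (hAm.compl.inter h2)

end Phase

/-! ### The failure probability of a phase -/

section PhaseProb
variable {Tok : Type*} [Fintype Tok] {X : Set (Str Tok)} [MeasurableSpace X] {V : X → Tok → Bool}
  {T : ℕ} {πs : Model Tok} {ntp : CoTData X T → Model Tok}

lemma ae_oracle_correct (ρ : Measure X) [IsProbabilityMeasure ρ]
    (hV : ∀ a, MeasurableSet {x : X | V x a = true}) (hT : 1 ≤ T)
    (hcot : ∀ y, MeasurableSet {x : X | cot πs x T = y})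
    (hacc : acc ρ V (fun x => answer πs x T) = 1) :
    ∀ᵐ x ∂ρ, V x (answer πs x T) = true := by
  have hm : MeasurableSet {x : X | V x (answer πs x T) = true} :=
    (measurableSet_answer_oracle hT hcot).measurableSet_correct hV measurable_id
  have h1 : acc ρ V (fun x => answer πs x T) = ρ.real {x : X | V x (answer πs x T) = true} := by
    rw [← integral_indicator_one hm, acc]
    congr 1
    funext x
    by_cases hx : V x (answer πs x T) = true <;> simp [hx]
  rw [h1] at hacc
  rw [ae_iff_prob_eq_one (p := fun x : X => V x (answer πs x T) = true) hm.mem]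
  rw [measureReal_def] at hacc
  exact (ENNReal.toReal_eq_one_iff _).1 hacc

/-- For a fixed ensemble, a phase on `b` fresh prompts rarely fails: either too few prompts are
accepted, or the base learner has large error on independent samples from the accepted prompts. -/
lemma iidE_phaseFails_le [DecidableEq Tok] (ρ : Measure X) [IsProbabilityMeasure ρ] (hT : 1 ≤ T)
    (hV : ∀ a, MeasurableSet {x : X | V x a = true})
    {H : Set (Model Tok)} {d : ℕ} (hd : Ndim H = d) (hπ : πs ∈ H)
    (hcot : ∀ y, MeasurableSet {x : X | cot πs x T = y})
    (hacc : acc ρ V (fun x => answer πs x T) = 1)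
    (hntp : IsNTP H ntp) (hmeas : MeasurableLearner ntp) (k cap b : ℕ)
    {ens : List (Model Tok)} (hens : ∀ π ∈ ens, MeasAnswer T (fun _ : X => π) id)
    {t : ℝ} (ht : 0 ≤ t) {z : ℝ} (hz : 0 < z) (hz1 : z ≤ 1) :
    iidE (ρ.prod (volume : Measure I)) b ({l | PhaseFails V T k ρ (ENNReal.ofReal t) ens
        (ntp ((sampleLoop V T k cap ens l ⟨[], []⟩).out.map fun x => (x, cot πs x T)))}.indicator
          1) ≤
      ENNReal.ofReal (2 ^ cap * (1 - t / 2) ^ b + (z⁻¹) ^ d *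
        (1 + (Fintype.card Tok : ℝ) ^ 2 * z) ^ (2 * cap * T) * (4 / 5) ^ cap) := by
  set μ := ρ.prod (volume : Measure I) with hμ
  set p := acceptMass V T k ρ ens Set.univ with hp
  by_cases hθ : p ≤ ENNReal.ofReal t
  · refine le_trans (iidE_mono μ (G := fun _ => 0) fun l _ => ?_)
      (by rw [iidE_const]; exact zero_le)
    rw [Set.indicator_of_notMem]
    exact fun h => (not_lt.2 hθ) h.1
  rw [not_le] at hθ
  set q := accProb V T k ens with hqdef
  have hq : Measurable q := measurable_accProb_const k hV hens
  have hq0 : ∀ x, 0 ≤ q x := accProb_nonneg V T k ens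
  have hq1 : ∀ x, q x ≤ 1 := accProb_le_one V T k ens
  have hp' : p = ∫⁻ x, ENNReal.ofReal (q x) ∂ρ := by simp [hp, acceptMass, hqdef]
  have hp0 : p ≠ 0 := (zero_le.trans_lt hθ).ne'
  have hp1 : p ≤ 1 := by
    rw [hp']
    calc ∫⁻ x, ENNReal.ofReal (q x) ∂ρ ≤ ∫⁻ _, 1 ∂ρ :=
          lintegral_mono fun x => ENNReal.ofReal_le_one.2 (hq1 x)
      _ = 1 := by simp
  have hpt : p ≠ ⊤ := (hp1.trans_lt ENNReal.one_lt_top).ne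
  have ht1 : t < 1 := by
    have := hθ.trans_le hp1
    rwa [ENNReal.ofReal_lt_one] at this
  -- The distribution of an accepted prompt.
  let D : Measure X := p⁻¹ • ρ.withDensity fun x => ENNReal.ofReal (q x)
  have hDi : ∀ φ : X → ENNReal, Measurable φ →
      ∫⁻ x, φ x ∂D = p⁻¹ * ∫⁻ x, ENNReal.ofReal (q x) * φ x ∂ρ := by
    intro φ hφ
    rw [lintegral_smul_measure, lintegral_withDensity_eq_lintegral_mul _ hq.ennreal_ofReal hφ]
    rfl
  have hDs : ∀ S : Set X, MeasurableSet S → D S = p⁻¹ * acceptMass V T k ρ ens S := by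
    intro S hS
    have h1 := hDi (S.indicator 1) (measurable_one.indicator hS)
    rw [lintegral_indicator_one hS] at h1
    rw [h1]
    congr 1
    refine lintegral_congr fun x => ?_
    by_cases hx : x ∈ S <;> simp [hx, hqdef]
  have : IsProbabilityMeasure D := ⟨by
    rw [hDs _ MeasurableSet.univ]
    exact ENNReal.inv_mul_cancel hp0 hpt⟩
  have hDac : D ≪ ρ := Measure.AbsolutelyContinuous.smul_left
    (withDensity_absolutelyContinuous _ _) _
  have hDμ : ∀ φ : X → ENNReal, Measurable φ →
      ∫⁻ z in {z : X × I | (z.2 : ℝ) ≤ accProb V T k ens z.1}, φ z.1 ∂μ = p * ∫⁻ x, φ x ∂D := by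
    intro φ hφ
    rw [hDi φ hφ, ← mul_assoc, ENNReal.mul_inv_cancel hp0 hpt, one_mul]
    exact lintegral_accept ρ hq hq0 hq1 hφ
  let lab : X → X × (Fin T → Tok) := fun x => (x, cot πs x T)
  let err : List X → Set X := fun l => {x | answer (ntp (l.map lab)) x T ≠ answer πs x T}
  let g : List X → ENNReal := {l | 1 / 4 < D (err l)}.indicator 1
  have hg : ∀ m, Measurable fun v : Fin m → X => g (List.ofFn v) := by
    intro m
    have h1 := measurable_measure_prodMk_left (ν := D) (hmeas.measurableSet_error hT hcot m)
    exact measurable_one.indicator (measurableSet_lt measurable_const h1)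
  -- The oracle is almost surely correct, so that a wrong answer deviates from the oracle.
  have hfail : ∀ l : List X, PhaseFails V T k ρ (ENNReal.ofReal t) ens (ntp (l.map lab)) →
      1 / 4 < D (err l) := by
    intro l hl
    have hW : MeasurableSet (wrongSet (X := X) V T (ntp (l.map lab))) :=
      measurableSet_wrongSet hV (hmeas.measAnswer_const _)
    have h1 : D (wrongSet V T (ntp (l.map lab))) ≤ D (err l) := by
      refine measure_mono_ae ?_
      filter_upwards [hDac.ae_le (ae_oracle_correct ρ hV hT hcot hacc)] with x hx hxW
      intro heq
      have h2 : V x (answer (ntp (l.map lab)) x T) = false := hxW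
      rw [heq, hx] at h2
      exact absurd h2 (by simp)
    refine lt_of_lt_of_le ?_ h1
    rw [hDs _ hW, ← ENNReal.mul_lt_mul_iff_right (a := 4 * p) (by simp [hp0])
      (ENNReal.mul_ne_top (by norm_num) hpt)]
    have e1 : 4 * p * (1 / 4) = p := by
      rw [mul_right_comm, one_div, ENNReal.mul_inv_cancel (by norm_num) (by norm_num), one_mul]
    have e2 : 4 * p * (p⁻¹ * acceptMass V T k ρ ens (wrongSet V T (ntp (l.map lab)))) =
        4 * acceptMass V T k ρ ens (wrongSet V T (ntp (l.map lab))) := by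
      rw [mul_assoc, ← mul_assoc p, ENNReal.mul_inv_cancel hp0 hpt, one_mul]
    rw [e1, e2]
    exact hl.2
  let loop : List (X × I) → List X := fun l => (sampleLoop V T k cap ens l ⟨[], []⟩).out
  have hsplit : ∀ l : List (X × I), ({l | PhaseFails V T k ρ (ENNReal.ofReal t) ens
      (ntp ((loop l).map lab))}.indicator 1 : List (X × I) → ENNReal) l ≤
      (if (loop l).length < cap then 1 else 0) +
        (if cap ≤ (loop l).length then g (loop l) else 0) := by
    intro l
    by_cases hl : PhaseFails V T k ρ (ENNReal.ofReal t) ens (ntp ((loop l).map lab))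
    · rw [Set.indicator_of_mem (by exact hl)]
      rcases lt_or_ge (loop l).length cap with h | h
      · simp [h]
      · have : g (loop l) = 1 := Set.indicator_of_mem (by exact hfail _ hl) _
        simp [h, this]
    · rw [Set.indicator_of_notMem (by exact hl)]
      exact zero_le
  have hF : Measurable fun v : Fin b → X × I =>
      (if (loop (List.ofFn v)).length < cap then (1 : ENNReal) else 0) := by
    refine Measurable.ite ?_ measurable_const measurable_const
    have h1 := measurableSet_sampleLoop (Ω := Fin b → X × I) (T := T) hV k cap
      (ens.map fun π _ => π) (List.ofFn fun i v => v i)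
      (by
        intro u hu
        obtain ⟨i, rfl⟩ := (List.mem_ofFn' _ _).1 hu
        exact measurable_pi_apply i)
      (by
        intro M hM u hu
        obtain ⟨i, rfl⟩ := (List.mem_ofFn' _ _).1 hu
        obtain ⟨π, hπ, rfl⟩ := List.mem_map.1 hM
        exact (hens π hπ).comp (measurable_fst.comp (measurable_pi_apply i)))
      (Q := fun _ l => l.length < cap)
      (by
        intro us _
        simp only [List.length_map]
        exact MeasurableSet.const _)
      [] (by simp) (fun _ => [])
    simpa [List.map_map, Function.comp_def, List.map_ofFn] using h1
  refine (iidE_mono μ fun l _ => hsplit l).trans ((iidE_add_le μ hF).trans ?_)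
  have hA := measurableSet_accept hq
  -- The Chernoff factor of a single trial.
  have hr : ∫⁻ z, (if (z.2 : ℝ) ≤ accProb V T k ens z.1 then 2⁻¹ else 1) ∂μ ≤
      ENNReal.ofReal (1 - t / 2) := by
    have h1 : ∫⁻ z, (if (z.2 : ℝ) ≤ accProb V T k ens z.1 then 2⁻¹ else 1) ∂μ + 2⁻¹ * p = 1 := by
      have h2 : ∫⁻ z, Set.indicator {z : X × I | (z.2 : ℝ) ≤ q z.1} (fun _ => (2⁻¹ : ENNReal)) z ∂μ
          = 2⁻¹ * p := by
        rw [lintegral_indicator hA]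
        have h3 := hDμ (fun _ => 2⁻¹) measurable_const
        rw [mul_comm]
        simpa using h3
      rw [← h2, ← lintegral_add_right _ (measurable_const.indicator hA)]
      have h4 : ∀ z : X × I, (if (z.2 : ℝ) ≤ accProb V T k ens z.1 then (2⁻¹ : ENNReal) else 1) +
          Set.indicator {z : X × I | (z.2 : ℝ) ≤ q z.1} (fun _ => (2⁻¹ : ENNReal)) z = 1 := by
        intro z
        by_cases hz : (z.2 : ℝ) ≤ accProb V T k ens z.1
        · rw [if_pos hz, Set.indicator_of_mem (by exact hz), ENNReal.inv_two_add_inv_two]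
        · rw [if_neg hz, Set.indicator_of_notMem (by exact hz), add_zero]
      simp only [h4]
      simp
    have h5 : ENNReal.ofReal (1 - t / 2) = 1 - 2⁻¹ * ENNReal.ofReal t := by
      rw [ENNReal.ofReal_sub _ (by positivity), ENNReal.ofReal_one, div_eq_inv_mul,
        ENNReal.ofReal_mul (by norm_num), ENNReal.ofReal_inv_of_pos (by norm_num)]
      norm_num
    rw [h5]
    have h6 : 2⁻¹ * ENNReal.ofReal t ≤ 2⁻¹ * p := by gcongr
    refine le_trans ?_ (tsub_le_tsub_left h6 1)
    exact ENNReal.le_sub_of_add_le_right (by finiteness) h1.le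
  have hshort := (iidE_sampleLoop_short V T k cap ens μ hq b ⟨[], []⟩)
  have hfull := (iidE_sampleLoop_full V T k cap ens μ hq D p hDμ hg b ⟨[], []⟩)
  rw [ENNReal.ofReal_add (mul_nonneg (by positivity) (pow_nonneg (by linarith) _))
    (by positivity)]
  refine add_le_add (hshort.trans ?_) (hfull.trans ?_)
  · rw [ENNReal.ofReal_mul (by positivity), ENNReal.ofReal_pow (by norm_num),
      ENNReal.ofReal_pow (by linarith)]
    simp only [List.length_nil, Nat.sub_zero]
    gcongr
    simp
  · simp only [List.length_nil, Nat.sub_zero, List.nil_append]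
    rw [← lintegral_pi_ofFn D cap (hg cap)]
    have hlearn := hntp.prob_large_error_le hT hd hπ hmeas hcot D cap hz hz1
    have hbad : MeasurableSet {v : Fin cap → X | 1 / 4 < D (err (List.ofFn v))} :=
      measurableSet_lt measurable_const
        (measurable_measure_prodMk_left (hmeas.measurableSet_error hT hcot cap))
    have h1 : ∫⁻ v, g (List.ofFn v) ∂(Measure.pi fun _ : Fin cap => D) =
        (Measure.pi fun _ : Fin cap => D) {v | 1 / 4 < D (err (List.ofFn v))} := by
      rw [← lintegral_indicator_one hbad]
      rfl
    rw [h1, ENNReal.ofReal_mul (by positivity)]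
    have h54 : (5 / 4 : ENNReal) ^ cap * ENNReal.ofReal ((4 / 5) ^ cap) = 1 := by
      have : (5 / 4 : ENNReal) = ENNReal.ofReal (5 / 4) := by
        rw [ENNReal.ofReal_div_of_pos (by norm_num)]
        norm_num
      rw [this, ← ENNReal.ofReal_pow (by norm_num), ← ENNReal.ofReal_mul (by positivity),
        ← mul_pow]
      norm_num
    calc _ = (Measure.pi fun _ : Fin cap => D) {v | 1 / 4 < D (err (List.ofFn v))} *
          ((5 / 4 : ENNReal) ^ cap * ENNReal.ofReal ((4 / 5) ^ cap)) := by rw [h54, mul_one]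
      _ ≤ _ := by
        rw [← mul_assoc]
        gcongr

end PhaseProb

/-! ### The run of the algorithm -/

section Run
variable {Tok : Type*} {X : Set (Str Tok)} {V : X → Tok → Bool} {T : ℕ}
  {oracle : X → Fin T → Tok} {ntp : CoTData X T → Model Tok} {k cap : ℕ}

/-- The accepted prompts of phase `j`. -/
noncomputable def phaseOut (V : X → Tok → Bool) (oracle : X → Fin T → Tok)
    (ntp : CoTData X T → Model Tok) (k cap : ℕ) (data : List (X × I)) (j : ℕ) : List X :=
  (sampleLoop V T k cap (run V oracle ntp k cap data j).models
    ((data.drop (j * (data.length / k))).take (data.length / k)) ⟨[], []⟩).out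

/-- The model trained in phase `j`. -/
noncomputable def phaseModel (V : X → Tok → Bool) (oracle : X → Fin T → Tok)
    (ntp : CoTData X T → Model Tok) (k cap : ℕ) (data : List (X × I)) (j : ℕ) : Model Tok :=
  ntp ((phaseOut V oracle ntp k cap data j).map fun x => (x, oracle x))

lemma run_succ_models (data : List (X × I)) (j : ℕ) :
    (run V oracle ntp k cap data (j + 1)).models =
      (run V oracle ntp k cap data j).models ++ [phaseModel V oracle ntp k cap data j] := rfl

lemma length_run_models (data : List (X × I)) (j : ℕ) :
    (run V oracle ntp k cap data j).models.length = j := by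
  induction j with
  | zero => rfl
  | succ j ih => rw [run_succ_models, List.length_append, ih]; rfl

lemma mem_run_models {data : List (X × I)} {j : ℕ} {π : Model Tok}
    (h : π ∈ (run V oracle ntp k cap data j).models) : ∃ D, π = ntp D := by
  induction j with
  | zero => simp [run] at h
  | succ j ih =>
    rw [run_succ_models, List.mem_append, List.mem_singleton] at h
    rcases h with h | h
    · exact ih h
    · exact ⟨_, h⟩

/-- The models of the first `j` phases depend only on the first `j` blocks. -/
lemma run_models_congr {l l' : List (X × I)} (hlen : l.length = l'.length) (j : ℕ)
    (h : l.take (j * (l.length / k)) = l'.take (j * (l.length / k))) :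
    (run V oracle ntp k cap l j).models = (run V oracle ntp k cap l' j).models := by
  induction j with
  | zero => rfl
  | succ j ih =>
    have hj := ih (by
      have h2 := congrArg (List.take (j * (l.length / k))) h
      rw [List.take_take, List.take_take,
        min_eq_left (Nat.mul_le_mul_right _ (Nat.le_succ j))] at h2
      exact h2)
    have hb : (l.drop (j * (l.length / k))).take (l.length / k) =
        (l'.drop (j * (l'.length / k))).take (l'.length / k) := by
      rw [← hlen]
      have h2 := congrArg (List.drop (j * (l.length / k))) h
      rw [List.drop_take, List.drop_take, Nat.succ_mul, Nat.add_sub_cancel_left] at h2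
      exact h2
    rw [run_succ_models, run_succ_models, hj, phaseModel, phaseModel, phaseOut, phaseOut, hj, hb]

lemma length_sampleLoop_graded_le (ens : List (Model Tok)) (l : List (X × I))
    (s : SampleState X) :
    (sampleLoop V T k cap ens l s).graded.length ≤ s.graded.length + l.length := by
  induction l generalizing s with
  | nil => exact le_rfl
  | cons z l ih =>
    rw [sampleLoop_cons]
    split_ifs
    · omega
    all_goals
      refine (ih _).trans ?_
      simp only [List.length_append, List.length_cons, List.length_nil]
      omega

lemma sum_sampleLoop_graded_le (ens : List (Model Tok)) (l : List (X × I))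
    (s : SampleState X) :
    ((sampleLoop V T k cap ens l s).graded.map fun q => q.2.length).sum ≤
      (s.graded.map fun q => q.2.length).sum + l.length * ens.length := by
  induction l generalizing s with
  | nil => simp [sampleLoop]
  | cons z l ih =>
    rw [sampleLoop_cons]
    split_ifs
    · omega
    all_goals
      refine (ih _).trans ?_
      simp only [List.map_append, List.sum_append, List.map_cons, List.map_nil, List.sum_cons,
        List.sum_nil, List.length_map, List.length_cons, Nat.succ_mul]
      omega

lemma length_sampleLoop_out_le (ens : List (Model Tok)) (l : List (X × I))
    (s : SampleState X) (hs : s.out.length ≤ cap) :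
    (sampleLoop V T k cap ens l s).out.length ≤ cap := by
  induction l generalizing s with
  | nil => exact hs
  | cons z l ih =>
    rw [sampleLoop_cons]
    split_ifs
    · exact hs
    · refine ih _ ?_
      simp only [List.length_append, List.length_singleton]
      omega
    · exact ih _ hs

lemma length_block_le (data : List (X × I)) (j : ℕ) :
    ((data.drop (j * (data.length / k))).take (data.length / k)).length ≤ data.length / k := by
  rw [List.length_take]
  exact min_le_left _ _

lemma length_run_graded_le (data : List (X × I)) (j : ℕ) :
    (run V oracle ntp k cap data j).graded.length ≤ j * (data.length / k) := by
  induction j with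
  | zero => simp [run]
  | succ j ih =>
    have h1 := length_sampleLoop_graded_le (V := V) (T := T) (k := k) (cap := cap)
      (run V oracle ntp k cap data j).models
      ((data.drop (j * (data.length / k))).take (data.length / k)) ⟨[], []⟩
    have h2 := length_block_le (k := k) data j
    simp only [run, List.length_append, Nat.succ_mul]
    simp only [List.length_nil] at h1
    omega

lemma sum_run_graded_le (data : List (X × I)) {j : ℕ} (hj : j ≤ k) :
    ((run V oracle ntp k cap data j).graded.map fun q => q.2.length).sum ≤
      j * (data.length / k) * k := by
  induction j with
  | zero => simp [run]
  | succ j ih =>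
    have h1 := sum_sampleLoop_graded_le (V := V) (T := T) (k := k) (cap := cap)
      (run V oracle ntp k cap data j).models
      ((data.drop (j * (data.length / k))).take (data.length / k)) ⟨[], []⟩
    have hlen : (run V oracle ntp k cap data j).models.length ≤ k :=
      (length_run_models data j).le.trans (Nat.le_of_succ_le hj)
    have h2 := Nat.mul_le_mul (length_block_le (k := k) data j) hlen
    have h3 := ih (by omega)
    simp only [run, List.map_append, List.sum_append]
    rw [Nat.succ_mul, Nat.add_mul]
    simp only [List.map_nil, List.sum_nil] at h1
    omega

lemma length_run_cotQueries_le (data : List (X × I)) (j : ℕ) :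
    (run V oracle ntp k cap data j).cotQueries.length ≤ j * cap := by
  induction j with
  | zero => simp [run]
  | succ j ih =>
    have h1 := length_sampleLoop_out_le (V := V) (T := T) (k := k) (cap := cap)
      (run V oracle ntp k cap data j).models
      ((data.drop (j * (data.length / k))).take (data.length / k)) ⟨[], []⟩ (by simp)
    simp only [run, List.length_append, Nat.succ_mul]
    omega

end Run

/-! ### Measurability and failure probability in a run -/

section Measure
variable {Tok : Type*} [Fintype Tok] {X : Set (Str Tok)} [MeasurableSpace X] {V : X → Tok → Bool}
  {T : ℕ} {πs : Model Tok} {ntp : CoTData X T → Model Tok}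

omit [Fintype Tok] in
lemma measAnswer_run_models (hntp : MeasurableLearner ntp) (data : List (X × I)) (k cap j : ℕ)
    {oracle : X → Fin T → Tok} :
    ∀ π ∈ (run V oracle ntp k cap data j).models, MeasAnswer T (fun _ : X => π) id := by
  intro π h
  obtain ⟨D, rfl⟩ := mem_run_models h
  exact hntp.measAnswer_const D

/-- Jointly in the data and in the prompt at which it is evaluated, the model of a phase is
measurable, provided that its ensemble is. -/
lemma measAnswer_phase (hV : ∀ a, MeasurableSet {x : X | V x a = true})
    (hntp : MeasurableLearner ntp) (hcot : ∀ y, MeasurableSet {x : X | cot πs x T = y})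
    (k cap : ℕ) {n : ℕ} (Ms : List ((Fin n → X × I) → Model Tok))
    (hMs : ∀ M ∈ Ms, MeasAnswer T (fun p : (Fin n → X × I) × X => M p.1) Prod.snd) (a b : ℕ) :
    MeasAnswer T (fun p : (Fin n → X × I) × X => ntp ((sampleLoop V T k cap
      (Ms.map fun M => M p.1) (((List.ofFn p.1).drop a).take b) ⟨[], []⟩).out.map
        fun x => (x, cot πs x T))) Prod.snd := by
  intro c
  let zs : List ((Fin n → X × I) × X → X × I) :=
    ((List.ofFn fun i (p : (Fin n → X × I) × X) => p.1 i).drop a).take b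
  have hzs : ∀ z ∈ zs, Measurable z := by
    intro z hz
    obtain ⟨i, rfl⟩ := (List.mem_ofFn' _ _).1 (List.mem_of_mem_drop (List.mem_of_mem_take hz))
    exact (measurable_pi_apply i).comp measurable_fst
  have hzs' : ∀ p, (zs.map fun z => z p) = ((List.ofFn p.1).drop a).take b := by
    intro p
    simp [zs, List.map_take, List.map_drop, List.map_ofFn, Function.comp_def]
  have h1 := measurableSet_sampleLoop (Ω := (Fin n → X × I) × X) (T := T) hV k cap
    (Ms.map fun M p => M p.1) zs hzs
    (by
      intro M' hM' z hz
      obtain ⟨M, hM, rfl⟩ := List.mem_map.1 hM'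
      exact (hMs M hM).comp (f := fun p : (Fin n → X × I) × X => (p.1, (z p).1))
        (measurable_fst.prodMk (measurable_fst.comp (hzs z hz))))
    (Q := fun p l => answer (ntp (l.map fun x => (x, cot πs x T))) p.2 T = c)
    (fun us hus => hntp.measAnswer hcot us hus measurable_snd c)
    [] (by simp) (fun _ => [])
  simpa only [hzs', List.map_map, Function.comp_def, List.map_nil] using h1

lemma exists_measurable_models (hV : ∀ a, MeasurableSet {x : X | V x a = true})
    (hntp : MeasurableLearner ntp) (hcot : ∀ y, MeasurableSet {x : X | cot πs x T = y})
    (k cap n j : ℕ) : ∃ Ms : List ((Fin n → X × I) → Model Tok),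
      (∀ ω, (run V (fun x => cot πs x T) ntp k cap (List.ofFn ω) j).models =
        Ms.map fun M => M ω) ∧
      ∀ M ∈ Ms, MeasAnswer T (fun p : (Fin n → X × I) × X => M p.1) Prod.snd := by
  induction j with
  | zero => exact ⟨[], fun _ => rfl, by simp⟩
  | succ j ih =>
    obtain ⟨Ms, h1, h2⟩ := ih
    refine ⟨Ms ++ [fun ω => phaseModel V (fun x => cot πs x T) ntp k cap (List.ofFn ω) j],
      fun ω => ?_, fun M hM => ?_⟩
    · rw [run_succ_models, h1, List.map_append]
      rfl
    · rcases List.mem_append.1 hM with hM | hM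
      · exact h2 M hM
      · rw [List.mem_singleton.1 hM]
        have h3 := measAnswer_phase hV hntp hcot k cap Ms h2 (j * (n / k)) (n / k)
        simpa only [phaseModel, phaseOut, h1, List.length_ofFn] using h3

lemma measurableSet_phaseFails (hV : ∀ a, MeasurableSet {x : X | V x a = true}) (k : ℕ)
    (ρ : Measure X) [IsProbabilityMeasure ρ] (θ : ENNReal) {Ω : Type*} [MeasurableSpace Ω]
    (Ms : List (Ω → Model Tok))
    (hMs : ∀ M ∈ Ms, MeasAnswer T (fun p : Ω × X => M p.1) Prod.snd) {M : Ω → Model Tok}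
    (hM : MeasAnswer T (fun p : Ω × X => M p.1) Prod.snd) :
    MeasurableSet {ω | PhaseFails V T k ρ θ (Ms.map fun M => M ω) (M ω)} := by
  have hq : Measurable fun p : Ω × X => accProb V T k (Ms.map fun M => M p.1) p.2 := by
    have := measurable_accProb hV k (measurable_snd (α := Ω) (β := X))
      (Ms.map fun M p => M p.1) (by simpa using hMs)
    simpa [List.map_map, Function.comp_def] using this
  have h1 : Measurable fun ω => acceptMass V T k ρ (Ms.map fun M => M ω) Set.univ := by
    simp only [acceptMass, Set.indicator_univ]
    exact hq.ennreal_ofReal.lintegral_prod_right'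
  have h2 : Measurable fun ω =>
      acceptMass V T k ρ (Ms.map fun M => M ω) (wrongSet V T (M ω)) := by
    have hW : MeasurableSet {p : Ω × X | V p.2 (answer (M p.1) p.2 T) = true}ᶜ :=
      (hM.measurableSet_correct hV measurable_snd).compl
    have h3 := (hq.ennreal_ofReal.indicator hW).lintegral_prod_right' (ν := ρ)
    convert h3 using 1
    funext ω
    refine lintegral_congr fun x => ?_
    by_cases hx : V x (answer (M ω) x T) = true <;> simp [wrongSet, hx]
  exact (measurableSet_lt measurable_const h1).inter (measurableSet_lt h1 (h2.const_mul 4))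

/-- The probability that phase `j` fails is at most the largest failure probability of a phase with
a fixed ensemble, because the block of phase `j` is independent of its ensemble. -/
lemma prob_phaseFails_le (hV : ∀ a, MeasurableSet {x : X | V x a = true})
    (hntp : MeasurableLearner ntp) (hcot : ∀ y, MeasurableSet {x : X | cot πs x T = y})
    (ρ : Measure X) [IsProbabilityMeasure ρ] {k cap n j : ℕ} (hj : j < k) (θ B : ENNReal)
    (hB : ∀ ens : List (Model Tok), (∀ π ∈ ens, MeasAnswer T (fun _ : X => π) id) →
      iidE (ρ.prod (volume : Measure I)) (n / k) ({l | PhaseFails V T k ρ θ ens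
        (ntp ((sampleLoop V T k cap ens l ⟨[], []⟩).out.map fun x => (x, cot πs x T)))}.indicator
          1) ≤ B) :
    (Measure.pi fun _ : Fin n => ρ.prod (volume : Measure I)) {ω |
      PhaseFails V T k ρ θ (run V (fun x => cot πs x T) ntp k cap (List.ofFn ω) j).models
        (phaseModel V (fun x => cot πs x T) ntp k cap (List.ofFn ω) j)} ≤ B := by
  set μ := ρ.prod (volume : Measure I)
  set orc : X → Fin T → Tok := fun x => cot πs x T with horc
  set S : Set (List (X × I)) := {l | PhaseFails V T k ρ θ (run V orc ntp k cap l j).models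
    (phaseModel V orc ntp k cap l j)} with hS
  have hSm : MeasurableSet {ω : Fin n → X × I | List.ofFn ω ∈ S} := by
    obtain ⟨Ms, h1, h2⟩ := exists_measurable_models hV hntp hcot k cap n j
    have h3 := measAnswer_phase hV hntp hcot k cap Ms h2 (j * (n / k)) (n / k)
    have h4 := measurableSet_phaseFails hV k ρ θ Ms h2
      (M := fun ω : Fin n → X × I => ntp ((sampleLoop V T k cap (Ms.map fun M => M ω)
        (((List.ofFn ω).drop (j * (n / k))).take (n / k)) ⟨[], []⟩).out.map
          fun x => (x, cot πs x T))) h3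
    have h5 : {ω : Fin n → X × I | List.ofFn ω ∈ S} = {ω | PhaseFails V T k ρ θ
        (Ms.map fun M => M ω) (ntp ((sampleLoop V T k cap (Ms.map fun M => M ω)
          (((List.ofFn ω).drop (j * (n / k))).take (n / k)) ⟨[], []⟩).out.map
            fun x => (x, cot πs x T)))} := by
      ext ω
      simp only [hS, Set.mem_ofPred_eq, phaseModel, phaseOut, h1, List.length_ofFn, horc]
    rw [h5]
    exact h4
  have h1 : (Measure.pi fun _ : Fin n => μ) {ω | List.ofFn ω ∈ S} =
      iidE μ n (S.indicator 1) := by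
    rw [← lintegral_pi_ofFn μ n (measurable_one.indicator hSm), ← lintegral_indicator_one hSm]
    rfl
  refine h1.le.trans ?_
  set b := n / k with hb
  have hkb : (j + 1) * b ≤ n := (Nat.mul_le_mul_right b hj).trans (Nat.mul_div_le n k)
  obtain ⟨r, hr⟩ : ∃ r, n = j * b + (b + r) :=
    ⟨n - (j + 1) * b, by rw [Nat.succ_mul] at hkb; rw [Nat.succ_mul]; omega⟩
  obtain ⟨F, hF⟩ : ∃ F : List (X × I) → ENNReal, F = S.indicator 1 := ⟨_, rfl⟩
  rw [← hF]
  have h2 : iidE μ n F = iidE μ (j * b) fun l₁ => iidE μ b fun l₂ => iidE μ r fun l₃ =>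
      F (l₁ ++ (l₂ ++ l₃)) := by
    conv_lhs => rw [hr]
    rw [iidE_append]
    simp only [iidE_append]
  rw [h2]
  refine (iidE_mono μ (G := fun _ => B) fun l₁ hl₁ => ?_).trans (by rw [iidE_const])
  rcases isEmpty_or_nonempty (X × I) with he | ⟨⟨z₀⟩⟩
  · have : IsEmpty X := ⟨fun x => he.elim (x, 0)⟩
    exact absurd (Measure.eq_zero_of_isEmpty ρ) (IsProbabilityMeasure.ne_zero ρ)
  -- The ensemble of phase `j` is determined by the first `j` blocks `l₁`.
  set ens := (run V orc ntp k cap (l₁ ++ List.replicate (b + r) z₀) j).models with hens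
  refine le_trans (iidE_mono μ fun l₂ hl₂ => ?_)
    (hB ens (measAnswer_run_models hntp _ k cap j))
  refine (iidE_mono μ fun l₃ hl₃ => ?_).trans (iidE_const μ r _).le
  have hlen : (l₁ ++ (l₂ ++ l₃)).length = n := by
    simp only [List.length_append, hl₁, hl₂, hl₃]
    exact hr.symm
  have hmod : (run V orc ntp k cap (l₁ ++ (l₂ ++ l₃)) j).models = ens := by
    refine run_models_congr ?_ j ?_
    · rw [hlen, List.length_append, List.length_replicate, hl₁]
      exact hr
    · rw [hlen, ← hb, List.take_left' hl₁, List.take_left' hl₁]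
  have hblk : ((l₁ ++ (l₂ ++ l₃)).drop (j * ((l₁ ++ (l₂ ++ l₃)).length / k))).take
      ((l₁ ++ (l₂ ++ l₃)).length / k) = l₂ := by
    rw [hlen, ← hb, List.drop_left' hl₁, List.take_left' hl₂]
  refine le_of_eq ?_
  rw [hF]
  refine Set.indicator_eq_indicator (f := 1) (g := 1) ?_ rfl
  simp only [hS, Set.mem_ofPred_eq, phaseModel, phaseOut, hmod, hblk]
  exact Iff.rfl

/-- If no phase fails, the potential grows by at most the threshold in each phase. -/
lemma potential_run_le (hV : ∀ a, MeasurableSet {x : X | V x a = true})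
    (hntp : MeasurableLearner ntp) {oracle : X → Fin T → Tok}
    (ρ : Measure X) [IsProbabilityMeasure ρ] {k cap : ℕ} {t : ℝ} (ht : 0 ≤ t)
    (data : List (X × I))
    (hok : ∀ j < k, ¬ PhaseFails V T k ρ (ENNReal.ofReal t)
      (run V oracle ntp k cap data j).models (phaseModel V oracle ntp k cap data j))
    {j : ℕ} (hj : j ≤ k) :
    potential V T k ρ (run V oracle ntp k cap data j).models ≤ beta k 0 0 + j * t := by
  induction j with
  | zero => simp [potential, run, rank]
  | succ j ih =>
    have h1 := potential_append_le k ρ hV (measAnswer_run_models hntp data k cap j)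
      (hntp.measAnswer_const ((phaseOut V oracle ntp k cap data j).map fun x => (x, oracle x)))
      (by rw [length_run_models]; omega) ht (hok j (by omega))
    have h2 := ih (by omega)
    rw [run_succ_models]
    push_cast
    refine h1.trans ?_
    linarith

end Measure

/-! ### Choice of the constants -/

section Numerics
variable {C c ε δ : ℝ} {d T s : ℕ}

lemma log_one_div_errStar : 1 ≤ Real.log (1 / errStar) ∧ Real.log (1 / errStar) ≤ 2 := by
  have h2 : Real.log (1 / errStar) = 2 * Real.log 2 := by
    rw [errStar, one_div_one_div, show (4 : ℝ) = 2 ^ 2 by norm_num, Real.log_pow]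
    norm_num
  have := Real.log_two_gt_d9
  have := Real.log_two_lt_d9
  rw [h2]
  constructor <;> linarith

lemma nPrompt_lower (hc : 20 ≤ c) (hT : 1 ≤ T) (hs : 1 ≤ s) (hδ : 0 < δ) (hδ1 : δ < 1) :
    80 * (d * Real.log (T * s) + Real.log (1 / δ)) ≤ nPrompt c d errStar δ T s := by
  have hTs : 0 ≤ Real.log ((T : ℝ) * s) := Real.log_nonneg (by exact_mod_cast Nat.mul_pos hT hs)
  have hl : 0 < Real.log (1 / δ) := Real.log_pos (one_lt_one_div hδ hδ1)
  have h4 := log_one_div_errStar.1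
  refine le_trans ?_ (Nat.le_ceil _)
  have hd : 0 ≤ (d : ℝ) * Real.log (T * s) := by positivity
  have h1 : d * Real.log (T * s) + Real.log (1 / δ) ≤
      d * Real.log (T * s) * Real.log (1 / errStar) + Real.log (1 / δ) := by nlinarith
  set Y := d * Real.log (T * s) * Real.log (1 / errStar) + Real.log (1 / δ)
  have h2 : c * (Y / errStar) = 4 * c * Y := by rw [errStar]; ring
  rw [h2]
  nlinarith

lemma nPrompt_upper (hc : 0 ≤ c) (hT : 1 ≤ T) (hs : 1 ≤ s) (hδ : 0 < δ) (hδ1 : δ < 1) :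
    (nPrompt c d errStar δ T s : ℝ) ≤
      4 * c * (2 * (d * Real.log (T * s)) + Real.log (1 / δ)) + 1 := by
  have hTs : 0 ≤ Real.log ((T : ℝ) * s) := Real.log_nonneg (by exact_mod_cast Nat.mul_pos hT hs)
  have hl : 0 < Real.log (1 / δ) := Real.log_pos (one_lt_one_div hδ hδ1)
  have h4 := log_one_div_errStar
  have hd : 0 ≤ (d : ℝ) * Real.log (T * s) := by positivity
  have hY : 0 ≤ d * Real.log (T * s) * Real.log (1 / errStar) + Real.log (1 / δ) := by
    have := mul_nonneg hd (zero_le_one.trans h4.1)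
    linarith
  have h1 : d * Real.log (T * s) * Real.log (1 / errStar) + Real.log (1 / δ) ≤
      2 * (d * Real.log (T * s)) + Real.log (1 / δ) := by nlinarith [h4.2]
  set Y := d * Real.log (T * s) * Real.log (1 / errStar) + Real.log (1 / δ)
  have h2 : c * (Y / errStar) = 4 * c * Y := by rw [errStar]; ring
  have h3 : (nPrompt c d errStar δ T s : ℝ) < c * (Y / errStar) + 1 :=
    Nat.ceil_lt_add_one (mul_nonneg hc (div_nonneg hY (by norm_num [errStar])))
  rw [h2] at h3
  refine h3.le.trans ?_
  gcongr

/-- The learner error bound, with the parameter of the cover chosen as `1 / (20 s² T)`: the number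
of patterns on `2m` prompts is then at most `(20 s² T)^d exp (m/10)`, which `(4/5)^m ≤ exp (-m/5)`
beats. -/
lemma learner_failure_le (hc : 20 ≤ c) (hT : 1 ≤ T) (hs : 1 ≤ s) (hds : d ≠ 0 → 2 ≤ s)
    (hδ : 0 < δ) (hδ1 : δ < 1 / 2) :
    ((1 / (20 * (s : ℝ) ^ 2 * T))⁻¹) ^ d *
      (1 + (s : ℝ) ^ 2 * (1 / (20 * (s : ℝ) ^ 2 * T))) ^ (2 * nPrompt c d errStar δ T s * T) *
        (4 / 5) ^ nPrompt c d errStar δ T s ≤ δ / 2 := by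
  have hlow := nPrompt_lower (d := d) hc hT hs hδ (by linarith)
  set m := nPrompt c d errStar δ T s
  have hT' : (1 : ℝ) ≤ T := by exact_mod_cast hT
  have hs' : (1 : ℝ) ≤ s := by exact_mod_cast hs
  set ℓ := Real.log ((T : ℝ) * s)
  set lam := Real.log (1 / δ) with hlam
  have hl2 : Real.log 2 ≤ lam :=
    Real.log_le_log (by norm_num) (by rw [le_div_iff₀ hδ]; linarith)
  have hlog2 : 0 < Real.log 2 := Real.log_pos (by norm_num)
  have h1 : ((1 / (20 * (s : ℝ) ^ 2 * T))⁻¹) ^ d ≤ Real.exp (7 * (d * ℓ)) := by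
    rcases eq_or_ne d 0 with rfl | hd
    · simp
    have hTs : (2 : ℝ) ≤ T * s := by
      have : 2 ≤ T * s := (hds hd).trans (Nat.le_mul_of_pos_left s hT)
      exact_mod_cast this
    have h2 : (1 / (20 * (s : ℝ) ^ 2 * T))⁻¹ ≤ Real.exp (7 * ℓ) := by
      rw [one_div, inv_inv, mul_comm 7, Real.exp_mul, Real.exp_log (by linarith),
        show (7 : ℝ) = ((7 : ℕ) : ℝ) by norm_num, Real.rpow_natCast]
      calc 20 * (s : ℝ) ^ 2 * T ≤ 2 ^ 5 * ((T : ℝ) * s) ^ 2 := by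
            have : (T : ℝ) ≤ T ^ 2 := by nlinarith
            have h3 : (s : ℝ) ^ 2 * T ≤ s ^ 2 * T ^ 2 := by gcongr
            have h4 : 0 ≤ (s : ℝ) ^ 2 * T ^ 2 := by positivity
            rw [mul_pow]
            linarith
        _ ≤ ((T : ℝ) * s) ^ 5 * ((T : ℝ) * s) ^ 2 := by gcongr
        _ = (T * s : ℝ) ^ 7 := by ring
    calc ((1 / (20 * (s : ℝ) ^ 2 * T))⁻¹) ^ d ≤ Real.exp (7 * ℓ) ^ d := by gcongr
      _ = Real.exp (7 * (d * ℓ)) := by rw [← Real.exp_nat_mul]; congr 1; ring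
  have h2 : (1 + (s : ℝ) ^ 2 * (1 / (20 * (s : ℝ) ^ 2 * T))) ^ (2 * m * T) ≤
      Real.exp (m / 10) := by
    have e : (s : ℝ) ^ 2 * (1 / (20 * (s : ℝ) ^ 2 * T)) = 1 / (20 * T) := by field_simp
    rw [e]
    calc (1 + 1 / (20 * (T : ℝ))) ^ (2 * m * T) ≤ Real.exp (1 / (20 * T)) ^ (2 * m * T) := by
          gcongr
          rw [add_comm]
          exact Real.add_one_le_exp _
      _ = Real.exp (m / 10) := by
          rw [← Real.exp_nat_mul]
          congr 1
          push_cast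
          field_simp
          ring
  have h3 : (4 / 5 : ℝ) ^ m ≤ Real.exp (-(m / 5)) := by
    calc (4 / 5 : ℝ) ^ m ≤ Real.exp (-(1 / 5)) ^ m := by
          gcongr
          have := Real.add_one_le_exp (-(1 / 5) : ℝ)
          linarith
      _ = Real.exp (-(m / 5)) := by rw [← Real.exp_nat_mul]; congr 1; ring
  calc _ ≤ Real.exp (7 * (d * ℓ)) * Real.exp (m / 10) * Real.exp (-(m / 5)) := by gcongr
    _ = Real.exp (7 * (d * ℓ) + m / 10 + -(m / 5)) := by rw [Real.exp_add, Real.exp_add]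
    _ ≤ Real.exp (-(lam + Real.log 2)) := by
        have hℓ : 0 ≤ d * ℓ := mul_nonneg (by positivity)
          (Real.log_nonneg (by exact_mod_cast Nat.mul_pos hT hs))
        exact Real.exp_le_exp.2 (by linarith)
    _ = δ / 2 := by
        rw [neg_add, Real.exp_add, Real.exp_neg, Real.exp_neg, Real.exp_log (by positivity),
          Real.exp_log (by norm_num), one_div, inv_inv]
        rfl

/-- The Chernoff bound for a block of `b` prompts when prompts are accepted with probability `t`. -/
lemma sampling_failure_le {t : ℝ} (ht1 : t ≤ 2) (hδ : 0 < δ) (hδ1 : δ < 1 / 2) {m b : ℕ}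
    (hb : m + 2 * Real.log (1 / δ) ≤ t * b / 2) : 2 ^ m * (1 - t / 2) ^ b ≤ δ / 2 := by
  have hl2 : Real.log 2 ≤ Real.log (1 / δ) :=
    Real.log_le_log (by norm_num) (by rw [le_div_iff₀ hδ]; linarith)
  calc 2 ^ m * (1 - t / 2) ^ b ≤ Real.exp 1 ^ m * Real.exp (-(t / 2)) ^ b := by
        have h1 := Real.add_one_le_exp (1 : ℝ)
        have h2 := Real.add_one_le_exp (-(t / 2))
        have h3 : 0 ≤ 1 - t / 2 := by linarith
        gcongr <;> linarith
    _ = Real.exp (m - t * b / 2) := by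
        rw [← Real.exp_nat_mul, ← Real.exp_nat_mul, ← Real.exp_add]
        congr 1
        ring
    _ ≤ Real.exp (-(Real.log (1 / δ) + Real.log 2)) := Real.exp_le_exp.2 (by linarith)
    _ = δ / 2 := by
        rw [neg_add, Real.exp_add, Real.exp_neg, Real.exp_neg, Real.exp_log (by positivity),
          Real.exp_log (by norm_num), one_div, inv_inv]
        rfl

/-- Bound for the number of phases: `numPhases C ε ≤ phaseConst C * log (Ts / (εδ))`. -/
noncomputable def phaseConst (C : ℝ) : ℝ := 16 * C + 2

/-- Bound for the number of accepted prompts: at most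
`promptConst C c * max d 1 * log (Ts / (εδ))` per phase. -/
noncomputable def promptConst (C c : ℝ) : ℝ := 4 * c * (phaseConst C + 3) + 2

/-- The constant of the polylogarithmic factor. -/
noncomputable def polyConst (C c : ℝ) : ℝ :=
  4 * phaseConst C + 8 * phaseConst C ^ 2 * (promptConst C c + 2 * phaseConst C + 2)

lemma polylog_bound_data {k cap lam K N D L : ℝ} (hε : 0 < ε) (hε1 : ε < 1) (hk : 0 ≤ k)
    (hlam0 : 0 ≤ lam) (hcap0 : 0 ≤ cap) (hK1 : 1 ≤ K) (hD1 : 1 ≤ D)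
    (hL2 : 1 ≤ 2 * L) (hkL : k ≤ K * L) (hlam : lam ≤ (K + 1) * L) (hcap : cap ≤ N * (D * L)) :
    k * (1 + 8 * k / ε * (cap + 2 * lam)) ≤
      D / ε * ((4 * K + 8 * K ^ 2 * (N + 2 * K + 2)) * L ^ 3) := by
  have hL0 : 0 < L := by linarith
  have h1 : cap + 2 * lam ≤ (N + 2 * K + 2) * (D * L) := by
    have h2 : (K + 1) * L ≤ (K + 1) * (D * L) := by
      have : L ≤ D * L := le_mul_of_one_le_left hL0.le hD1
      gcongr
    linarith
  have h3 : k * (8 * k / ε * (cap + 2 * lam)) ≤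
      (K * L) * (8 * (K * L) / ε * ((N + 2 * K + 2) * (D * L))) := by gcongr
  have h4 : k ≤ D / ε * (4 * K * L ^ 3) := by
    have h5 : 1 ≤ D / ε := by rw [le_div_iff₀ hε]; linarith
    have hLL : 1 ≤ 4 * L ^ 2 := by nlinarith
    calc k ≤ K * L * 1 := by linarith
      _ ≤ K * L * (4 * L ^ 2) := by gcongr
      _ = 1 * (4 * K * L ^ 3) := by ring
      _ ≤ D / ε * (4 * K * L ^ 3) := by gcongr
  calc k * (1 + 8 * k / ε * (cap + 2 * lam))
      = k + k * (8 * k / ε * (cap + 2 * lam)) := by ring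
    _ ≤ D / ε * (4 * K * L ^ 3) +
        (K * L) * (8 * (K * L) / ε * ((N + 2 * K + 2) * (D * L))) := add_le_add h4 h3
    _ = D / ε * ((4 * K + 8 * K ^ 2 * (N + 2 * K + 2)) * L ^ 3) := by ring

lemma polylog_bound_oracle {k cap K N D L : ℝ} (hcap0 : 0 ≤ cap) (hK1 : 1 ≤ K) (hD1 : 1 ≤ D)
    (hN0 : 0 ≤ N) (hL2 : 1 ≤ 2 * L) (hkL : k ≤ K * L) (hcap : cap ≤ N * (D * L)) :
    k * cap ≤ D * ((4 * K + 8 * K ^ 2 * (N + 2 * K + 2)) * L ^ 3) := by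
  have hL0 : 0 < L := by linarith
  have h1 : 2 * K * N ≤ 4 * K + 8 * K ^ 2 * (N + 2 * K + 2) := by
    have h2 : K * N ≤ K ^ 2 * N := by
      have : K ≤ K ^ 2 := by nlinarith
      gcongr
    have h3 : 0 ≤ K ^ 2 * (2 * K + 2) := by positivity
    have h4 : 0 ≤ K ^ 2 * N := by positivity
    have h5 : 8 * K ^ 2 * (N + 2 * K + 2) = 8 * (K ^ 2 * N) + 8 * (K ^ 2 * (2 * K + 2)) := by ring
    linarith
  calc k * cap ≤ (K * L) * (N * (D * L)) := by gcongr
    _ = D * (K * N * L ^ 2) * 1 := by ring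
    _ ≤ D * (K * N * L ^ 2) * (2 * L) := by gcongr
    _ = D * (2 * K * N * L ^ 3) := by ring
    _ ≤ D * ((4 * K + 8 * K ^ 2 * (N + 2 * K + 2)) * L ^ 3) := by gcongr

/-- The polylogarithmic factor dominates both the data set size that all phases together need and
the number of oracle queries. -/
lemma polylog_bounds (hC : 1 ≤ C) (hc : 20 ≤ c) (hT : 1 ≤ T) (hs : 1 ≤ s) (hε : 0 < ε)
    (hε1 : ε < 1) (hδ : 0 < δ) (hδ1 : δ < 1 / 2) :
    (numPhases C ε : ℝ) * (1 + 8 * numPhases C ε / ε *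
        (nPrompt c d errStar (δ / numPhases C ε) T s + 2 * Real.log (1 / (δ / numPhases C ε)))) ≤
      ((max d 1 : ℕ) : ℝ) / ε * polylog (polyConst C c) 3 ε δ T s ∧
    (numPhases C ε : ℝ) * nPrompt c d errStar (δ / numPhases C ε) T s ≤
      ((max d 1 : ℕ) : ℝ) * polylog (polyConst C c) 3 ε δ T s := by
  have hk1 : (1 : ℝ) ≤ numPhases C ε := by
    exact_mod_cast one_le_numPhases (C := C) (by linarith) hε hε1
  have hkup : (numPhases C ε : ℝ) < 16 * (C * Real.log (1 / ε)) + 1 := by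
    have hl : 0 < Real.log (1 / ε) := Real.log_pos (one_lt_one_div hε hε1)
    have h := Nat.ceil_lt_add_one (a := C * Real.log (1 / ε) / errStar ^ 2)
      (by rw [errStar]; positivity)
    refine h.trans_le (le_of_eq ?_)
    rw [errStar]
    ring
  set k := numPhases C ε
  have hTs : (1 : ℝ) ≤ T * s := by exact_mod_cast Nat.mul_pos hT hs
  rw [polylog]
  set L := Real.log (T * s / (ε * δ)) with hL
  have hk0 : (0 : ℝ) < k := by linarith
  have hδk : 0 < δ / k := by positivity
  have hδk1 : δ / k < 1 := by rw [div_lt_one hk0]; linarith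
  have hεδ : ε * δ ≤ 1 / 2 := by nlinarith
  have hL2 : 1 ≤ 2 * L := by
    have h1 : Real.log 2 ≤ L := Real.log_le_log (by norm_num) (by
      rw [le_div_iff₀ (by positivity)]; linarith)
    have := Real.log_two_gt_d9
    linarith
  have hLε : Real.log (1 / ε) ≤ L := Real.log_le_log (by positivity) (by
    rw [div_le_div_iff₀ hε (by positivity)]; nlinarith)
  have hLδ : Real.log (1 / δ) ≤ L := Real.log_le_log (by positivity) (by
    rw [div_le_div_iff₀ hδ (by positivity)]; nlinarith)
  have hLT : Real.log (T * s) ≤ L := Real.log_le_log (by positivity) (by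
    rw [le_div_iff₀ (by positivity)]; nlinarith)
  have hkL : (k : ℝ) ≤ phaseConst C * L := by
    rw [phaseConst]
    nlinarith
  set K := phaseConst C with hK
  have hK1 : 1 ≤ K := by rw [hK, phaseConst]; linarith
  have hlam : Real.log (1 / (δ / k)) ≤ (K + 1) * L := by
    rw [one_div_div, div_eq_mul_one_div, Real.log_mul (by positivity) (by positivity)]
    have := Real.log_le_self hk0.le
    linarith
  set D : ℝ := ((max d 1 : ℕ) : ℝ) with hD
  have hD1 : 1 ≤ D := by rw [hD]; exact_mod_cast le_max_right d 1
  have hdD : (d : ℝ) ≤ D := by rw [hD]; exact_mod_cast le_max_left d 1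
  have hL0 : 0 < L := by linarith
  have hcap : (nPrompt c d errStar (δ / k) T s : ℝ) ≤ promptConst C c * (D * L) := by
    refine (nPrompt_upper (by linarith) hT hs hδk hδk1).trans ?_
    have hlT0 : 0 ≤ Real.log ((T : ℝ) * s) := Real.log_nonneg hTs
    have h1 : d * Real.log (T * s) ≤ D * L := by gcongr
    have h2 : L ≤ D * L := by nlinarith
    have h3 : (K + 1) * L ≤ (K + 1) * (D * L) := by gcongr
    rw [promptConst, ← hK]
    have h4 : 2 * (d * Real.log (T * s)) + Real.log (1 / (δ / k)) ≤ (K + 3) * (D * L) := by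
      linarith
    have h5 : 4 * c * (2 * (d * Real.log (T * s)) + Real.log (1 / (δ / k))) ≤
        4 * c * ((K + 3) * (D * L)) := by gcongr
    linarith
  set N := promptConst C c with hN
  have hN0 : 0 ≤ N := by rw [hN, promptConst]; positivity
  set cap : ℝ := (nPrompt c d errStar (δ / k) T s : ℝ)
  have hlam0 : 0 < Real.log (1 / (δ / k)) := Real.log_pos (one_lt_one_div hδk hδk1)
  exact ⟨polylog_bound_data hε hε1 hk0.le hlam0.le (Nat.cast_nonneg _) hK1 hD1 hL2 hkL hlam
    hcap, polylog_bound_oracle (Nat.cast_nonneg _) hK1 hD1 hN0 hL2 hkL hcap⟩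

end Numerics

end AutoTune

theorem mainTheorem1 :
    ∃ C₀ c₀ : ℝ, 0 < C₀ ∧ 0 < c₀ ∧ ∀ C ≥ C₀, ∀ c ≥ c₀, ∃ (A : ℝ) (p : ℕ), 0 < A ∧
    ∀ (Tok : Type*) [Fintype Tok] [DecidableEq Tok]
      (X : Set (AutoTune.Str Tok)) [MeasurableSpace X] (ρ : Measure X) [IsProbabilityMeasure ρ]
      (T : ℕ) (_ : 1 ≤ T)
      -- the sparse outcome verifier
      (V : X → Tok → Bool) (_ : ∀ a, MeasurableSet {x : X | V x a = true})
      (_ : AutoTune.Sparse V)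
      -- the class of deterministic models and the realizable perfect model
      (H : Set (AutoTune.Model Tok)) (d : ℕ) (_ : AutoTune.Ndim H = d)
      (πstar : AutoTune.Model Tok) (_ : πstar ∈ H)
      (_ : ∀ y, MeasurableSet {x : X | AutoTune.cot πstar x T = y})
      (_ : AutoTune.acc ρ V (fun x => AutoTune.answer πstar x T) = 1)
      -- the base learner and the plurality rule
      (ntp : AutoTune.CoTData X T → AutoTune.Model Tok)
      (_ : AutoTune.IsNTP H ntp) (_ : AutoTune.MeasurableLearner ntp)
      (plu : List Tok → Tok) (_ : AutoTune.IsPlurality plu)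
      (ε δ : ℝ) (_ : 0 < ε) (_ : ε < 1) (_ : 0 < δ) (_ : δ < 1 / 2)
      (n : ℕ) (_ : ((max d 1 : ℕ) : ℝ) / ε *
        AutoTune.polylog A p ε δ T (Fintype.card Tok) ≤ n),
      -- the final state of the run on prompts and uniform variables `ω`
      let final : (Fin n → X × unitInterval) → AutoTune.State X := fun ω =>
        AutoTune.autoTune C c d ε δ V (fun x => AutoTune.cot πstar x T) ntp (List.ofFn ω)
      (∀ ω, (final ω).graded.length ≤ n ∧
        ((final ω).graded.map fun q => q.2.length).sum ≤ n * AutoTune.numPhases C ε ∧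
        ((final ω).cotQueries.length : ℝ) ≤
          ((max d 1 : ℕ) : ℝ) * AutoTune.polylog A p ε δ T (Fintype.card Tok)) ∧
      1 - δ ≤ (Measure.pi fun _ : Fin n => ρ.prod (volume : Measure unitInterval)).real
        {ω | 1 - ε ≤ AutoTune.acc ρ V (AutoTune.vote plu T (final ω).models)} := by
  refine ⟨1, 20, by norm_num, by norm_num, fun C hC c hc => ?_⟩
  have hK : 0 < AutoTune.phaseConst C := by rw [AutoTune.phaseConst]; linarith
  have hN : 0 < AutoTune.promptConst C c := by
    rw [AutoTune.promptConst]
    have : 0 < c := by linarith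
    positivity
  refine ⟨AutoTune.polyConst C c, 3, by rw [AutoTune.polyConst]; positivity, ?_⟩
  intro Tok _ _ X _ ρ _ T hT V hV hsp H d hd πs hπ hcot hacc ntp hntp hmeas plu hplu ε δ hε hε1
    hδ hδ1 n hn final
  have hs : 1 ≤ Fintype.card Tok := Fintype.card_pos_iff.2 ⟨πs Stream'.Seq.nil⟩
  have hk := AutoTune.one_le_numPhases (C := C) (by linarith) hε hε1
  obtain ⟨hbn, hbq⟩ := AutoTune.polylog_bounds (d := d) hC hc hT hs hε hε1 hδ hδ1
  have hβ := AutoTune.beta_numPhases_le hC hε hε1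
  set k := AutoTune.numPhases C ε with hkdef
  set s := Fintype.card Tok
  set cap := AutoTune.nPrompt c d AutoTune.errStar (δ / k) T s with hcap
  have hfinal : ∀ ω, final ω =
      AutoTune.run V (fun x => AutoTune.cot πs x T) ntp k cap (List.ofFn ω) k := fun ω => rfl
  have hk' : (1 : ℝ) ≤ k := by exact_mod_cast hk
  have hk0 : (0 : ℝ) < k := by linarith
  refine ⟨fun ω => ⟨?_, ?_, ?_⟩, ?_⟩
  · rw [hfinal]
    refine (AutoTune.length_run_graded_le _ _).trans ?_
    rw [List.length_ofFn]
    exact Nat.mul_div_le n k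
  · rw [hfinal]
    refine (AutoTune.sum_run_graded_le _ le_rfl).trans ?_
    rw [List.length_ofFn]
    exact Nat.mul_le_mul_right _ (Nat.mul_div_le n k)
  · rw [hfinal]
    refine le_trans ?_ hbq
    exact_mod_cast AutoTune.length_run_cotQueries_le _ _
  have hδk : 0 < δ / k := by positivity
  have hδk1 : δ / k < 1 / 2 := by
    rw [div_lt_iff₀ hk0]
    nlinarith
  -- With this threshold, phases that run out of prompts cost at most `ε / 4` in total.
  set t : ℝ := ε / (4 * k) with ht
  have ht0 : 0 ≤ t := by positivity
  have ht2 : t ≤ 2 := by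
    rw [ht, div_le_iff₀ (by positivity)]
    nlinarith
  have hb : cap + 2 * Real.log (1 / (δ / k)) ≤ t * (n / k : ℕ) / 2 := by
    have h1 : (n : ℝ) < k * ((n / k : ℕ) + 1) := by
      exact_mod_cast Nat.lt_mul_div_succ n hk
    have h2 := (hbn.trans hn).trans_lt h1
    have h3 := lt_of_mul_lt_mul_left h2 hk0.le
    have h4 : t / 2 * (8 * k / ε) = 1 := by
      rw [ht]
      field_simp
      norm_num
    calc (cap : ℝ) + 2 * Real.log (1 / (δ / k))
        = t / 2 * (8 * k / ε * (cap + 2 * Real.log (1 / (δ / k)))) := by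
          rw [← mul_assoc, h4, one_mul]
      _ ≤ t / 2 * (n / k : ℕ) := by
          gcongr
          linarith
      _ = t * (n / k : ℕ) / 2 := by ring
  set z : ℝ := 1 / (20 * (s : ℝ) ^ 2 * T) with hz
  have hs' : (1 : ℝ) ≤ s := by exact_mod_cast hs
  have hT' : (1 : ℝ) ≤ T := by exact_mod_cast hT
  have hz0 : 0 < z := by positivity
  have hz1 : z ≤ 1 := by
    rw [hz, div_le_one (by positivity)]
    nlinarith [one_le_pow₀ hs' (n := 2)]
  set μ := Measure.pi fun _ : Fin n => ρ.prod (volume : Measure unitInterval) with hμ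
  let bad : Fin k → Set (Fin n → X × unitInterval) := fun j => {ω |
    AutoTune.PhaseFails V T k ρ (ENNReal.ofReal t)
      (AutoTune.run V (fun x => AutoTune.cot πs x T) ntp k cap (List.ofFn ω) j).models
      (AutoTune.phaseModel V (fun x => AutoTune.cot πs x T) ntp k cap (List.ofFn ω) j)}
  have hbad : ∀ j, μ (bad j) ≤ ENNReal.ofReal (δ / k) := by
    intro j
    refine AutoTune.prob_phaseFails_le hV hmeas hcot ρ j.2 _ _ fun ens hens => ?_
    refine (AutoTune.iidE_phaseFails_le ρ hT hV hd hπ hcot hacc hntp hmeas k cap (n / k) hens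
      ht0 hz0 hz1).trans (ENNReal.ofReal_le_ofReal ?_)
    have h1 := AutoTune.sampling_failure_le ht2 hδk hδk1 hb
    have h2 := AutoTune.learner_failure_le (d := d) hc hT hs
      (fun h => AutoTune.two_le_card_of_Ndim hd h) hδk hδk1
    linarith
  have hgood : ∀ ω, ω ∉ ⋃ j, bad j →
      1 - ε ≤ AutoTune.acc ρ V (AutoTune.vote plu T (final ω).models) := by
    intro ω hω
    rw [Set.mem_iUnion, not_exists] at hω
    have h1 := AutoTune.potential_run_le hV hmeas ρ ht0 (List.ofFn ω)
      (fun j hj => hω ⟨j, hj⟩) le_rfl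
    rw [hfinal]
    refine le_trans ?_ (AutoTune.one_sub_potential_le_acc k ρ hV hsp hplu
      (AutoTune.measAnswer_run_models hmeas (List.ofFn ω) k cap k)
      (AutoTune.length_run_models (List.ofFn ω) k))
    have h3 : k * t = ε / 4 := by
      rw [ht]
      field_simp
    linarith
  have h1 : (1 : ENNReal) ≤ μ {ω | 1 - ε ≤
      AutoTune.acc ρ V (AutoTune.vote plu T (final ω).models)} + ENNReal.ofReal δ := by
    calc (1 : ENNReal) = μ Set.univ := by rw [hμ, measure_univ]
      _ ≤ μ ({ω | 1 - ε ≤ AutoTune.acc ρ V (AutoTune.vote plu T (final ω).models)} ∪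
          ⋃ j, bad j) := by
          refine measure_mono fun ω _ => ?_
          by_cases h : ω ∈ ⋃ j, bad j
          · exact Or.inr h
          · exact Or.inl (hgood ω h)
      _ ≤ μ {ω | 1 - ε ≤ AutoTune.acc ρ V (AutoTune.vote plu T (final ω).models)} +
          ∑ j, μ (bad j) :=
          (measure_union_le _ _).trans (by gcongr; exact measure_iUnion_fintype_le _ _)
      _ ≤ _ := by
          gcongr
          calc ∑ j, μ (bad j) ≤ ∑ _j : Fin k, ENNReal.ofReal (δ / k) :=
                Finset.sum_le_sum fun j _ => hbad j
            _ = ENNReal.ofReal δ := by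
                rw [Finset.sum_const, Finset.card_univ, Fintype.card_fin, nsmul_eq_mul,
                  ← ENNReal.ofReal_natCast, ← ENNReal.ofReal_mul (by positivity),
                  mul_div_cancel₀ _ hk0.ne']
  have h2 := ENNReal.toReal_mono (by finiteness) h1
  rw [ENNReal.toReal_add (by finiteness) (by finiteness), ENNReal.toReal_ofReal hδ.le,
    ENNReal.toReal_one] at h2
  rw [measureReal_def]
  linarith
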